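/- Let the finite types be generated by the type $0$ (natural numbers) and $\sigma,\tau\mapsto(\sigma\to\tau)$, and put $1:=0\to0$, $n+1:=n\to 0$. Let $\mathsf{L}_\omega$ be the language of classical many-sorted predicate logic with variables of every finite type, application, the relations $=_0$ and $<_0$ on type $0$, and constants $0,1,+,\times$, the combinators $\Pi,\Sigma$ of all types and recursors $\mathbf R_\sigma$ for every finite type $\sigma$. Equality at a type $\tau=(\tau_1\to\dots\to\tau_k\to0)$ is defined by $x=_\tau y:\equiv(\forall z_1^{\tau_1},\dots,z_k^{\tau_k})(xz_1\dots z_k=_0yz_1\dots z_k)$. $\mathsf{RCA}_0^\omega$ is the theory in $\mathsf{L}_\omega$ with the following axioms: $0,1,+,\times,<_0$ form a discretely ordered commutative semi-ring with equality $=_0$; the defining equations of $\Pi$ and $\Sigma$; $\mathbf R_0(f,m,0)=m$ and $\mathbf R_0(f,m,n+1)=f(\mathbf R_0(f,m,n))$ for $f^1,m^0,n^0$; the extensionality axioms $x=_\rho y\to\varphi(x)=_\tau\varphi(y)$ for all types $\rho,\tau$ and $\varphi^{\rho\to\tau}$; induction for quantifier-free formulas of $\mathsf{L}_\omega$; and $\mathsf{QF\text{-}AC}^{1,0}$.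 Here $\mathsf{QF\text{-}AC}^{\sigma,\tau}$ is the schema $$(\forall x^\sigma)(\exists y^\tau)A(x,y)\to(\exists Y^{\sigma\to\tau})(\forall x^\sigma)A(x,Y(x))\qquad(A\text{ quantifier-free, with parameters of any types}).$$ $\mathsf{WKL}_0^\omega$ is $\mathsf{RCA}_0^\omega$ plus weak König's lemma $\mathsf{WKL}$ (every infinite binary tree has a path). Write $f\in C$ for $(\forall n^0)(f(n)\le1)$, write $\overline fN=\overline gN$ for $(\forall i<N)(f(i)=g(i))$, and write $Y^2\in\mathsf{cont}$ for $(\forall f^1)(\exists N^0)(\forall g^1)(\overline fN=\overline gN\to Y(f)=Y(g))$, that is, $Y$ is continuous on Baire space. Consider the sentences $$(\kappa_0^3):\quad(\exists\kappa_0^3)(\forall Y^2)\big[\kappa_0(Y)=0\leftrightarrow(\exists f\in C)(Y(f)>0)\big],$$ $$(Z^3):\quad(\exists Z^3)(\forall Y^2)\big[Z(Y)=0\leftrightarrow Y\in\mathsf{cont}\big],$$ $$\mathsf{FF}:\quad(\exists\Phi^3)(\forall Y^2\in\mathsf{cont})(\forall f,g\in C)\big(\overline f\Phi(Y)=\overline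 g\Phi(Y)\to Y(f)=Y(g)\big).$$ **Theorem.** The system $\mathsf{WKL}_0^\omega+\mathsf{QF\text{-}AC}^{2,0}$ proves $(\kappa_0^3)\leftrightarrow\big[(Z^3)\wedge\mathsf{FF}\big]$. -/

import Mathlib

/-! Higher-order arithmetic in all finite types: the language, classical many-sorted
predicate logic, and the theories `RCA₀^ω`, `WKL₀^ω`, `QF-AC`. -/

namespace HOA

/-- The finite types: `0` and `σ → τ`. -/
inductive Ty : Type
  | nat : Ty
  | arr (σ τ : Ty) : Ty

infixr:65 " ⇒ " => Ty.arr

/-- The pure types `0`, `1 = 0 → 0`, `2 = 1 → 0`, `3 = 2 → 0`. -/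
abbrev Ty.t0 : Ty := Ty.nat
abbrev Ty.t1 : Ty := Ty.t0 ⇒ Ty.t0
abbrev Ty.t2 : Ty := Ty.t1 ⇒ Ty.t0
abbrev Ty.t3 : Ty := Ty.t2 ⇒ Ty.t0

open Ty

/-- A context of free variables: `V σ` is the type of the variables of type `σ`. -/
abbrev Ctx : Type 1 := Ty → Type

/-- The empty context. -/
def Ctx.empty : Ctx := fun _ => Empty

/-- `V ▹ τ` is the context `V` with one new variable, of type `τ`. -/
inductive Ext (V : Ctx) (τ : Ty) : Ty → Type
  | new : Ext V τ τ
  | old {σ : Ty} (v : V σ) : Ext V τ σ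

infixl:64 " ▹ " => Ext

/-- The constants: `0`, `1`, `+`, `×`, the combinators `Π` (`K`) and `Σ` (`S`), the recursors. -/
inductive Con : Ty → Type
  | zero : Con t0
  | one : Con t0
  | add : Con (t0 ⇒ t0 ⇒ t0)
  | mul : Con (t0 ⇒ t0 ⇒ t0)
  | K (σ τ : Ty) : Con (σ ⇒ τ ⇒ σ)
  | S (ρ σ τ : Ty) : Con ((ρ ⇒ σ ⇒ τ) ⇒ (ρ ⇒ σ) ⇒ ρ ⇒ τ)
  | R (σ : Ty) : Con ((σ ⇒ σ) ⇒ σ ⇒ t0 ⇒ σ)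

/-- Terms with free variables in `V`. -/
inductive Tm (V : Ctx) : Ty → Type
  | var {σ : Ty} (v : V σ) : Tm V σ
  | con {σ : Ty} (c : Con σ) : Tm V σ
  | app {σ τ : Ty} (t : Tm V (σ ⇒ τ)) (s : Tm V σ) : Tm V τ

infixl:80 " ⬝ " => Tm.app

namespace Tm

variable {V W : Ctx}

instance : Zero (Tm V t0) := ⟨con Con.zero⟩
instance : One (Tm V t0) := ⟨con Con.one⟩
instance : Add (Tm V t0) := ⟨fun a b => con Con.add ⬝ a ⬝ b⟩
instance : Mul (Tm V t0) := ⟨fun a b => con Con.mul ⬝ a ⬝ b⟩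

/-- Renaming of variables. -/
def rename (r : ∀ σ, V σ → W σ) : {σ : Ty} → Tm V σ → Tm W σ
  | _, var v => var (r _ v)
  | _, con c => con c
  | _, app t s => app (t.rename r) (s.rename r)

/-- Simultaneous substitution of terms for the variables. -/
def subst (u : ∀ σ, V σ → Tm W σ) : {σ : Ty} → Tm V σ → Tm W σ
  | _, var v => u _ v
  | _, con c => con c
  | _, app t s => app (t.subst u) (s.subst u)

/-- Weakening: a term read in a context with one more variable. -/
def wk {τ σ : Ty} (t : Tm V σ) : Tm (V ▹ τ) σ := t.rename fun _ => Ext.old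

/-- The variables bound by the innermost, the second, the third, … quantifier. -/
def x0 {σ : Ty} : Tm (V ▹ σ) σ := var Ext.new
def x1 {σ τ : Ty} : Tm (V ▹ σ ▹ τ) σ := (x0 : Tm (V ▹ σ) σ).wk
def x2 {σ τ ρ : Ty} : Tm (V ▹ σ ▹ τ ▹ ρ) σ := (x1 : Tm (V ▹ σ ▹ τ) σ).wk

/-- Renamings and substitutions under a quantifier. -/
def liftRen {τ : Ty} (r : ∀ σ, V σ → W σ) : ∀ σ, (V ▹ τ) σ → (W ▹ τ) σ
  | _, Ext.new => Ext.new
  | _, Ext.old v => Ext.old (r _ v)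

def liftSub {τ : Ty} (u : ∀ σ, V σ → Tm W σ) : ∀ σ, (V ▹ τ) σ → Tm (W ▹ τ) σ
  | _, Ext.new => var Ext.new
  | _, Ext.old v => (u _ v).wk

end Tm

/-- Formulas with free variables in `V`. The primitive predicates are `=₀` and `<₀`; the
primitive logical symbols are `⊥`, `→` and `∀` (over every finite type). -/
inductive Fm : Ctx → Type 1
  | bot {V : Ctx} : Fm V
  | eq {V : Ctx} (s t : Tm V t0) : Fm V
  | lt {V : Ctx} (s t : Tm V t0) : Fm V
  | imp {V : Ctx} (A B : Fm V) : Fm V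
  | all {V : Ctx} (σ : Ty) (A : Fm (V ▹ σ)) : Fm V

infix:60 " =₀ " => Fm.eq
infix:60 " <₀ " => Fm.lt

/-- A sentence is a formula without free variables. -/
abbrev Sentence : Type 1 := Fm Ctx.empty

namespace Fm

variable {V W : Ctx}

/-- The other connectives, as usual in classical logic. -/
def not (A : Fm V) : Fm V := A.imp bot
def and (A B : Fm V) : Fm V := (A.imp B.not).not
def or (A B : Fm V) : Fm V := A.not.imp B
def iff (A B : Fm V) : Fm V := (A.imp B).and (B.imp A)
def ex (σ : Ty) (A : Fm (V ▹ σ)) : Fm V := (all σ A.not).not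

/-- `s ≤₀ t`. -/
def le (s t : Tm V t0) : Fm V := (s <₀ t).or (s =₀ t)

/-- Renaming of the free variables. -/
def rename : {V W : Ctx} → (∀ σ, V σ → W σ) → Fm V → Fm W
  | _, _, _, bot => bot
  | _, _, r, eq s t => eq (s.rename r) (t.rename r)
  | _, _, r, lt s t => lt (s.rename r) (t.rename r)
  | _, _, r, imp A B => imp (A.rename r) (B.rename r)
  | _, _, r, all σ A => all σ (A.rename (Tm.liftRen r))

/-- Simultaneous substitution of terms for the free variables. -/
def subst : {V W : Ctx} → (∀ σ, V σ → Tm W σ) → Fm V → Fm W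
  | _, _, _, bot => bot
  | _, _, u, eq s t => eq (s.subst u) (t.subst u)
  | _, _, u, lt s t => lt (s.subst u) (t.subst u)
  | _, _, u, imp A B => imp (A.subst u) (B.subst u)
  | _, _, u, all σ A => all σ (A.subst (Tm.liftSub u))

/-- Weakening: a formula read in a context with one more variable. -/
def wk {τ : Ty} (A : Fm V) : Fm (V ▹ τ) := A.rename fun _ => Ext.old

/-- The substitution of `t` for the new variable of `V ▹ τ`. -/
def instSub {τ : Ty} (t : Tm V τ) : ∀ σ, (V ▹ τ) σ → Tm V σ
  | _, Ext.new => t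
  | _, Ext.old v => Tm.var v

/-- `A(t)`. -/
def inst {τ : Ty} (A : Fm (V ▹ τ)) (t : Tm V τ) : Fm V := A.subst (instSub t)

/-- The substitution of `n + 1` for the new variable `n`. -/
def succSub : ∀ σ, (V ▹ t0) σ → Tm (V ▹ t0) σ
  | _, Ext.new => Tm.x0 + 1
  | _, Ext.old v => Tm.var (Ext.old v)

/-- The substitution that turns `A(x, y)` into `A(x, Y x)`, in the context `V, Y, x`. -/
def choiceSub {σ τ : Ty} : ∀ ρ, (V ▹ σ ▹ τ) ρ → Tm (V ▹ (σ ⇒ τ) ▹ σ) ρ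
  | _, Ext.new => Tm.x1 ⬝ Tm.x0
  | _, Ext.old Ext.new => Tm.x0
  | _, Ext.old (Ext.old v) => Tm.var (Ext.old (Ext.old v))

/-- Quantifier-free formulas (variables of every type are allowed). -/
def QF : {V : Ctx} → Fm V → Prop
  | _, bot => True
  | _, eq _ _ => True
  | _, lt _ _ => True
  | _, imp A B => A.QF ∧ B.QF
  | _, all _ _ => False

/-- Extensional equality `s =_τ t` at every finite type, defined from `=₀`. -/
def eqT : {V : Ctx} → (τ : Ty) → Tm V τ → Tm V τ → Fm V
  | _, nat, s, t => s =₀ t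
  | _, σ ⇒ τ, s, t => all σ (eqT τ (s.wk ⬝ Tm.x0) (t.wk ⬝ Tm.x0))

end Fm

/-! ### Provability -/

/-- A theory: its axioms. An axiom with free variables stands for its universal closure. -/
abbrev Theory : Type 1 := ∀ V : Ctx, Set (Fm V)

/-- Natural deduction for classical many-sorted predicate logic: `Prf T Δ A` says that `A` is
derivable from the axioms of `T` and the assumptions `Δ`. -/
inductive Prf (T : Theory) : {V : Ctx} → Set (Fm V) → Fm V → Prop
  | ax {V : Ctx} {Δ : Set (Fm V)} {A : Fm V} (h : A ∈ T V) : Prf T Δ A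
  | hyp {V : Ctx} {Δ : Set (Fm V)} {A : Fm V} (h : A ∈ Δ) : Prf T Δ A
  | impI {V : Ctx} {Δ : Set (Fm V)} {A B : Fm V} (h : Prf T (insert A Δ) B) : Prf T Δ (A.imp B)
  | impE {V : Ctx} {Δ : Set (Fm V)} {A B : Fm V} (h : Prf T Δ (A.imp B)) (h' : Prf T Δ A) :
      Prf T Δ B
  | raa {V : Ctx} {Δ : Set (Fm V)} {A : Fm V} (h : Prf T (insert A.not Δ) Fm.bot) : Prf T Δ A
  | allI {V : Ctx} {Δ : Set (Fm V)} {σ : Ty} {A : Fm (V ▹ σ)} (h : Prf T (Fm.wk '' Δ) A) :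
      Prf T Δ (Fm.all σ A)
  | allE {V : Ctx} {Δ : Set (Fm V)} {σ : Ty} {A : Fm (V ▹ σ)} (h : Prf T Δ (Fm.all σ A))
      (t : Tm V σ) : Prf T Δ (A.inst t)

/-- The theory `T` proves the sentence `A`. -/
def Proves (T : Theory) (A : Sentence) : Prop := Prf T ∅ A

/-- `T + U`. -/
def Theory.plus (T U : Theory) : Theory := fun V => T V ∪ U V

/-! ### The axioms -/

open Tm Fm

/-- The quantifier-free axiom of choice `QF-AC^{σ,τ}`:
`∀ x ∃ y A(x, y) → ∃ Y ∀ x A(x, Y x)` for quantifier-free `A`, with parameters. -/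
inductive QFAC (σ τ : Ty) : ∀ V : Ctx, Fm V → Prop
  | choice {V : Ctx} (A : Fm (V ▹ σ ▹ τ)) (hA : A.QF) :
      QFAC σ τ V ((all σ (ex τ A)).imp (ex (σ ⇒ τ) (all σ (A.subst choiceSub))))

/-- The axioms of `RCA₀^ω`. -/
inductive RCA0ω : ∀ V : Ctx, Fm V → Prop
  -- equality of numbers
  | eq_refl {V : Ctx} (a : Tm V t0) : RCA0ω V (a =₀ a)
  | eq_symm {V : Ctx} (a b : Tm V t0) : RCA0ω V ((a =₀ b).imp (b =₀ a))
  | eq_trans {V : Ctx} (a b c : Tm V t0) :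
      RCA0ω V ((a =₀ b).imp ((b =₀ c).imp (a =₀ c)))
  | lt_congr {V : Ctx} (a b c d : Tm V t0) :
      RCA0ω V ((a =₀ b).imp ((c =₀ d).imp ((a <₀ c).imp (b <₀ d))))
  -- the natural numbers form a (commutative, discretely) ordered semi-ring
  | add_assoc {V : Ctx} (a b c : Tm V t0) : RCA0ω V (a + b + c =₀ a + (b + c))
  | add_comm {V : Ctx} (a b : Tm V t0) : RCA0ω V (a + b =₀ b + a)
  | add_zero {V : Ctx} (a : Tm V t0) : RCA0ω V (a + 0 =₀ a)
  | mul_assoc {V : Ctx} (a b c : Tm V t0) : RCA0ω V (a * b * c =₀ a * (b * c))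
  | mul_comm {V : Ctx} (a b : Tm V t0) : RCA0ω V (a * b =₀ b * a)
  | mul_one {V : Ctx} (a : Tm V t0) : RCA0ω V (a * 1 =₀ a)
  | mul_zero {V : Ctx} (a : Tm V t0) : RCA0ω V (a * 0 =₀ 0)
  | mul_add {V : Ctx} (a b c : Tm V t0) : RCA0ω V (a * (b + c) =₀ a * b + a * c)
  | lt_irrefl {V : Ctx} (a : Tm V t0) : RCA0ω V (a <₀ a).not
  | lt_trans {V : Ctx} (a b c : Tm V t0) :
      RCA0ω V ((a <₀ b).imp ((b <₀ c).imp (a <₀ c)))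
  | lt_trichotomy {V : Ctx} (a b : Tm V t0) :
      RCA0ω V ((a <₀ b).or ((a =₀ b).or (b <₀ a)))
  | add_lt_add {V : Ctx} (a b c : Tm V t0) : RCA0ω V ((a <₀ b).imp (a + c <₀ b + c))
  | mul_lt_mul {V : Ctx} (a b c : Tm V t0) :
      RCA0ω V ((0 <₀ c).imp ((a <₀ b).imp (a * c <₀ b * c)))
  | not_lt_zero {V : Ctx} (a : Tm V t0) : RCA0ω V (a <₀ 0).not
  | lt_succ {V : Ctx} (a b : Tm V t0) : RCA0ω V ((a <₀ b + 1).iff (le a b))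
  -- the combinators
  | K_def {V : Ctx} {σ τ : Ty} (x : Tm V σ) (y : Tm V τ) :
      RCA0ω V (eqT σ (con (Con.K σ τ) ⬝ x ⬝ y) x)
  | S_def {V : Ctx} {ρ σ τ : Ty} (x : Tm V (ρ ⇒ σ ⇒ τ)) (y : Tm V (ρ ⇒ σ)) (z : Tm V ρ) :
      RCA0ω V (eqT τ (con (Con.S ρ σ τ) ⬝ x ⬝ y ⬝ z) (x ⬝ z ⬝ (y ⬝ z)))
  -- the recursor for numbers
  | R_zero {V : Ctx} (f : Tm V t1) (m : Tm V t0) :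
      RCA0ω V (con (Con.R t0) ⬝ f ⬝ m ⬝ 0 =₀ m)
  | R_succ {V : Ctx} (f : Tm V t1) (m n : Tm V t0) :
      RCA0ω V (con (Con.R t0) ⬝ f ⬝ m ⬝ (n + 1) =₀ f ⬝ (con (Con.R t0) ⬝ f ⬝ m ⬝ n))
  -- extensionality
  | ext {V : Ctx} {ρ τ : Ty} (x y : Tm V ρ) (φ : Tm V (ρ ⇒ τ)) :
      RCA0ω V ((eqT ρ x y).imp (eqT τ (φ ⬝ x) (φ ⬝ y)))
  -- quantifier-free induction
  | ind {V : Ctx} (A : Fm (V ▹ t0)) (hA : A.QF) :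
      RCA0ω V ((A.inst 0).imp ((all t0 (A.imp (A.subst succSub))).imp (all t0 A)))
  -- quantifier-free choice
  | qfac {V : Ctx} {A : Fm V} (h : QFAC t1 t0 V A) : RCA0ω V A

section Formulas

variable {V : Ctx}

/-- `f ∈ C`, that is, `f ≤₁ 1`. -/
def inC (f : Tm V t1) : Fm V := all t0 (le (f.wk ⬝ x0) 1)

/-- The initial segments of length `N` agree: `f(i) = g(i)` for all `i < N`. -/
def agree (f g : Tm V t1) (N : Tm V t0) : Fm V :=
  all t0 ((x0 <₀ N.wk).imp (f.wk ⬝ x0 =₀ g.wk ⬝ x0))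

/-- `Y` is continuous on Baire space:
`∀ f ∃ N ∀ g (f, g agree below N → Y f = Y g)`. -/
def cont (Y : Tm V t2) : Fm V :=
  all t1 (ex t0 (all t1 ((agree x2 x0 x1).imp
    (Y.wk.wk.wk ⬝ x2 =₀ Y.wk.wk.wk ⬝ x0))))

/-- `N` is a modulus of uniform continuity of `Y` on Cantor space. -/
def unifC (Y : Tm V t2) (N : Tm V t0) : Fm V :=
  all t1 (all t1 ((inC x1).imp ((inC x0).imp ((agree x1 x0 N.wk.wk).imp
    (Y.wk.wk ⬝ x1 =₀ Y.wk.wk ⬝ x0)))))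

/-! A finite binary sequence `s` is coded by the number with binary expansion `1s`. So the codes
are the numbers `t ≥ 1`, each coding one sequence, the empty sequence has the code `1`, and the two
one-step extensions of `t` are `2t` and `2t + 1`. -/

/-- `{t ≥ 1 : f(t) = 0}` is a binary tree: it is closed under initial segments. -/
def isTree (f : Tm V t1) : Fm V :=
  all t0 ((le 1 x0).imp
    (((f.wk ⬝ (x0 + x0) =₀ 0).or (f.wk ⬝ (x0 + x0 + 1) =₀ 0)).imp (f.wk ⬝ x0 =₀ 0)))

/-- The tree is infinite: it has arbitrarily large elements. -/
def isInfinite (f : Tm V t1) : Fm V :=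
  all t0 (ex t0 ((x1 <₀ x0).and (f.wk.wk ⬝ x0 =₀ 0)))

/-- `g(n)` is the code of the initial segment of `b` of length `n`, for all `n`. -/
def isSegments (b g : Tm V t1) : Fm V :=
  (g ⬝ 0 =₀ 1).and (all t0 (g.wk ⬝ (x0 + 1) =₀ g.wk ⬝ x0 + g.wk ⬝ x0 + b.wk ⬝ x0))

/-- `b ∈ C` is a path: all its initial segments belong to the tree. -/
def isPath (f b : Tm V t1) : Fm V :=
  (inC b).and (ex t1 ((isSegments b.wk x0).and (all t0 (f.wk.wk ⬝ (x1 ⬝ x0) =₀ 0))))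

/-- Weak König's lemma: every infinite binary tree has a path. -/
def WKL : Fm V :=
  all t1 (((isTree x0).and (isInfinite x0)).imp (ex t1 (isPath x1 x0)))

/-- `(κ₀³)`: `∃ κ ∀ Y (κ(Y) = 0 ↔ ∃ f ∈ C (Y(f) > 0))`. -/
def kappa0 : Fm V :=
  ex t3 (all t2 ((x1 ⬝ x0 =₀ 0).iff (ex t1 ((inC x0).and (0 <₀ x1 ⬝ x0)))))

/-- `(Z³)`: `∃ Z ∀ Y (Z(Y) = 0 ↔ Y is continuous on Baire space)`. -/
def Z3 : Fm V := ex t3 (all t2 ((x1 ⬝ x0 =₀ 0).iff (cont x0)))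

/-- `FF`: `∃ Φ ∀ Y ∈ cont`, `Φ(Y)` is a modulus of uniform continuity of `Y` on `C`. -/
def FF : Fm V := ex t3 (all t2 ((cont x0).imp (unifC x0 (x1 ⬝ x0))))

end Formulas

/-- `WKL₀^ω`, that is, `RCA₀^ω + WKL`. -/
def WKL0ω : Theory := Theory.plus RCA0ω (fun _ => {WKL})

end HOA

namespace HOA

open Ty Tm Fm

/-! ### Substitution -/

namespace Tm

variable {V W U : Ctx}

theorem rename_eq_subst (r : ∀ σ, V σ → W σ) {σ : Ty} (t : Tm V σ) :
    t.rename r = t.subst fun σ v => var (r σ v) := by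
  induction t with
  | var v => rfl
  | con c => rfl
  | app t s iht ihs => simp [rename, subst, iht, ihs]

theorem subst_subst (u : ∀ σ, V σ → Tm W σ) (w : ∀ σ, W σ → Tm U σ) {σ : Ty} (t : Tm V σ) :
    (t.subst u).subst w = t.subst fun σ v => (u σ v).subst w := by
  induction t with
  | var v => rfl
  | con c => rfl
  | app t s iht ihs => simp [subst, iht, ihs]

theorem subst_var {σ : Ty} (t : Tm V σ) : (t.subst fun _ v => var v) = t := by
  induction t with
  | var v => rfl
  | con c => rfl
  | app t s iht ihs => simp [subst, iht, ihs]

theorem wk_eq_subst {τ σ : Ty} (t : Tm V σ) :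
    (t.wk : Tm (V ▹ τ) σ) = t.subst fun _ v => var (Ext.old v) :=
  rename_eq_subst _ t

theorem wk_subst {τ σ : Ty} (t : Tm V σ) (u : ∀ σ, V σ → Tm W σ) :
    (t.wk : Tm (V ▹ τ) σ).subst (liftSub u) = (t.subst u).wk := by
  rw [wk_eq_subst, wk_eq_subst, subst_subst, subst_subst]
  congr 1
  funext σ v
  exact wk_eq_subst _

theorem liftSub_liftSub {τ : Ty} (u : ∀ σ, V σ → Tm W σ) (w : ∀ σ, W σ → Tm U σ) :
    (fun σ v => (liftSub (τ := τ) u σ v).subst (liftSub w)) =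
      liftSub fun σ v => (u σ v).subst w := by
  funext σ v
  cases v with
  | new => rfl
  | old v => exact wk_subst _ _

theorem liftSub_var {τ : Ty} :
    liftSub (τ := τ) (fun σ (v : V σ) => var v) = fun _ v => var v := by
  funext σ v
  cases v <;> rfl

theorem liftSub_ren {τ : Ty} (r : ∀ σ, V σ → W σ) :
    liftSub (τ := τ) (fun σ v => var (r σ v)) = fun σ v => var (liftRen r σ v) := by
  funext σ v
  cases v <;> rfl

/-- Every variable of the term satisfies `p`. -/
def VarsIn (p : ∀ σ, V σ → Prop) : {σ : Ty} → Tm V σ → Prop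
  | _, var v => p _ v
  | _, con _ => True
  | _, app t s => t.VarsIn p ∧ s.VarsIn p

/-- Predicates on variables and ranks of variables, under a quantifier. -/
def liftPred {τ : Ty} (p : ∀ σ, V σ → Prop) : ∀ σ, (V ▹ τ) σ → Prop
  | _, Ext.new => True
  | _, Ext.old v => p _ v

def liftRank {τ : Ty} (r : ∀ σ, V σ → ℕ) : ∀ σ, (V ▹ τ) σ → ℕ
  | _, Ext.new => 0
  | _, Ext.old v => r _ v

theorem VarsIn.mono {p q : ∀ σ, V σ → Prop} (h : ∀ σ v, p σ v → q σ v) {σ : Ty} {t : Tm V σ}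
    (ht : t.VarsIn p) : t.VarsIn q := by
  induction t with
  | var v => exact h _ _ ht
  | con c => trivial
  | app t s iht ihs => exact ⟨iht ht.1, ihs ht.2⟩

theorem VarsIn.subst_congr {p : ∀ σ, V σ → Prop} {u w : ∀ σ, V σ → Tm W σ}
    (h : ∀ σ v, p σ v → u σ v = w σ v) {σ : Ty} {t : Tm V σ} (ht : t.VarsIn p) :
    t.subst u = t.subst w := by
  induction t with
  | var v => exact h _ _ ht
  | con c => rfl
  | app t s iht ihs => simp only [subst, iht ht.1, ihs ht.2]

theorem exists_varsIn (r : ∀ σ, V σ → ℕ) {σ : Ty} (t : Tm V σ) :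
    ∃ n, t.VarsIn fun σ v => r σ v < n := by
  induction t with
  | var v => exact ⟨_, Nat.lt_succ_self _⟩
  | con c => exact ⟨0, trivial⟩
  | app t s iht ihs =>
    obtain ⟨m, hm⟩ := iht
    obtain ⟨n, hn⟩ := ihs
    exact ⟨max m n, hm.mono fun _ _ h => lt_max_of_lt_left h,
      hn.mono fun _ _ h => lt_max_of_lt_right h⟩

end Tm

namespace Fm

theorem rename_eq_subst {V W : Ctx} (r : ∀ σ, V σ → W σ) (A : Fm V) :
    A.rename r = A.subst fun σ v => var (r σ v) := by
  induction A generalizing W with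
  | bot => rfl
  | eq s t => simp [rename, subst, Tm.rename_eq_subst]
  | lt s t => simp [rename, subst, Tm.rename_eq_subst]
  | imp A B ihA ihB => simp [rename, subst, ihA, ihB]
  | all σ A ih => simp [rename, subst, ih, liftSub_ren]

theorem subst_subst {V W U : Ctx} (u : ∀ σ, V σ → Tm W σ) (w : ∀ σ, W σ → Tm U σ) (A : Fm V) :
    (A.subst u).subst w = A.subst fun σ v => (u σ v).subst w := by
  induction A generalizing W U with
  | bot => rfl
  | eq s t => simp [subst, Tm.subst_subst]
  | lt s t => simp [subst, Tm.subst_subst]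
  | imp A B ihA ihB => simp [subst, ihA, ihB]
  | all σ A ih => simp [subst, ih, liftSub_liftSub]

theorem subst_var {V : Ctx} (A : Fm V) : (A.subst fun _ v => var v) = A := by
  induction A with
  | bot => rfl
  | eq s t => simp [subst, Tm.subst_var]
  | lt s t => simp [subst, Tm.subst_var]
  | imp A B ihA ihB => simp [subst, ihA, ihB]
  | all σ A ih => simp [subst, ih, liftSub_var]

variable {V W : Ctx}

theorem wk_eq_subst {τ : Ty} (A : Fm V) :
    (A.wk : Fm (V ▹ τ)) = A.subst fun _ v => var (Ext.old v) :=
  rename_eq_subst _ A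

theorem wk_subst {τ : Ty} (A : Fm V) (u : ∀ σ, V σ → Tm W σ) :
    (A.wk : Fm (V ▹ τ)).subst (liftSub u) = (A.subst u).wk := by
  rw [wk_eq_subst, wk_eq_subst, subst_subst, subst_subst]
  congr 1
  funext σ v
  exact Tm.wk_eq_subst _

theorem subst_inst {τ : Ty} (A : Fm (V ▹ τ)) (t : Tm V τ) (u : ∀ σ, V σ → Tm W σ) :
    (A.inst t).subst u = (A.subst (liftSub u)).inst (t.subst u) := by
  rw [inst, inst, subst_subst, subst_subst]
  congr 1
  funext σ v
  cases v with
  | new => rfl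
  | old v =>
    change u _ v = ((u _ v).wk).subst _
    rw [Tm.wk_eq_subst, Tm.subst_subst]
    exact (Tm.subst_var _).symm

/-- Extends a substitution by a value for the new variable. -/
def consSub {τ : Ty} (u : ∀ σ, V σ → Tm W σ) (t : Tm W τ) : ∀ σ, (V ▹ τ) σ → Tm W σ
  | _, Ext.new => t
  | _, Ext.old v => u _ v

theorem inst_subst_liftSub {τ : Ty} (A : Fm (V ▹ τ)) (u : ∀ σ, V σ → Tm W σ) (t : Tm W τ) :
    (A.subst (liftSub u)).inst t = A.subst (consSub u t) := by
  rw [inst, subst_subst]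
  congr 1
  funext σ v
  cases v with
  | new => rfl
  | old v =>
    change ((u _ v).wk).subst _ = _
    rw [Tm.wk_eq_subst, Tm.subst_subst]
    exact Tm.subst_var _

theorem eqT_subst (τ : Ty) {V W : Ctx} (s t : Tm V τ) (u : ∀ σ, V σ → Tm W σ) :
    (eqT τ s t).subst u = eqT τ (s.subst u) (t.subst u) := by
  induction τ generalizing V W with
  | nat => rfl
  | arr σ τ _ ih => simp [eqT, subst, ih, Tm.subst, Tm.wk_subst, x0, liftSub]

theorem QF.subst {V W : Ctx} {A : Fm V} (h : A.QF) (u : ∀ σ, V σ → Tm W σ) :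
    (A.subst u).QF := by
  induction A generalizing W with
  | bot => trivial
  | eq s t => trivial
  | lt s t => trivial
  | imp A B ihA ihB => exact ⟨ihA h.1 u, ihB h.2 u⟩
  | all σ A ih => exact h.elim

/-- Every free variable of the formula satisfies `p`. -/
def VarsIn : {V : Ctx} → (∀ σ, V σ → Prop) → Fm V → Prop
  | _, _, bot => True
  | _, p, eq s t => s.VarsIn p ∧ t.VarsIn p
  | _, p, lt s t => s.VarsIn p ∧ t.VarsIn p
  | _, p, imp A B => A.VarsIn p ∧ B.VarsIn p
  | _, p, all _ A => A.VarsIn (liftPred p)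

theorem VarsIn.mono {V : Ctx} {p q : ∀ σ, V σ → Prop} (h : ∀ σ v, p σ v → q σ v) {A : Fm V}
    (hA : A.VarsIn p) : A.VarsIn q := by
  induction A with
  | bot => trivial
  | eq s t => exact ⟨hA.1.mono h, hA.2.mono h⟩
  | lt s t => exact ⟨hA.1.mono h, hA.2.mono h⟩
  | imp A B ihA ihB => exact ⟨ihA h hA.1, ihB h hA.2⟩
  | all σ A ih =>
    refine ih (fun τ v hv => ?_) hA
    cases v with
    | new => trivial
    | old v => exact h _ _ hv

theorem VarsIn.subst_congr {V W : Ctx} {p : ∀ σ, V σ → Prop} {u w : ∀ σ, V σ → Tm W σ}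
    (h : ∀ σ v, p σ v → u σ v = w σ v) {A : Fm V} (hA : A.VarsIn p) :
    A.subst u = A.subst w := by
  induction A generalizing W with
  | bot => rfl
  | eq s t => simp only [subst, hA.1.subst_congr h, hA.2.subst_congr h]
  | lt s t => simp only [subst, hA.1.subst_congr h, hA.2.subst_congr h]
  | imp A B ihA ihB => simp only [subst, ihA h hA.1, ihB h hA.2]
  | all σ A ih =>
    simp only [subst]
    congr 1
    refine ih (fun τ v hv => ?_) hA
    cases v with
    | new => rfl
    | old v => exact congrArg Tm.wk (h _ _ hv)

theorem exists_varsIn {V : Ctx} (r : ∀ σ, V σ → ℕ) (A : Fm V) :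
    ∃ n, A.VarsIn fun σ v => r σ v < n := by
  induction A with
  | bot => exact ⟨0, trivial⟩
  | eq s t =>
    obtain ⟨m, hm⟩ := s.exists_varsIn r
    obtain ⟨n, hn⟩ := t.exists_varsIn r
    exact ⟨max m n, hm.mono fun _ _ h => lt_max_of_lt_left h,
      hn.mono fun _ _ h => lt_max_of_lt_right h⟩
  | lt s t =>
    obtain ⟨m, hm⟩ := s.exists_varsIn r
    obtain ⟨n, hn⟩ := t.exists_varsIn r
    exact ⟨max m n, hm.mono fun _ _ h => lt_max_of_lt_left h,
      hn.mono fun _ _ h => lt_max_of_lt_right h⟩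
  | imp A B ihA ihB =>
    obtain ⟨m, hm⟩ := ihA r
    obtain ⟨n, hn⟩ := ihB r
    exact ⟨max m n, hm.mono fun _ _ h => lt_max_of_lt_left h,
      hn.mono fun _ _ h => lt_max_of_lt_right h⟩
  | all σ A ih =>
    obtain ⟨n, hn⟩ := ih (liftRank r)
    refine ⟨n, hn.mono fun τ v hv => ?_⟩
    cases v with
    | new => trivial
    | old v => exact hv

end Fm

/-! ### Admissible rules -/

/-- The axioms are closed under substitution. -/
def Theory.SubstClosed (T : Theory) : Prop :=
  ∀ ⦃V W : Ctx⦄ (u : ∀ σ, V σ → Tm W σ) ⦃A : Fm V⦄, A ∈ T V → A.subst u ∈ T W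

theorem Theory.SubstClosed.plus {T U : Theory} (hT : T.SubstClosed) (hU : U.SubstClosed) :
    (T.plus U).SubstClosed := fun _ _ u _ h =>
  h.imp (fun h => hT u h) fun h => hU u h

namespace Prf

variable {T : Theory} {V : Ctx} {Δ Δ' : Set (Fm V)} {A B : Fm V}

theorem mono (h : Prf T Δ A) (hΔ : Δ ⊆ Δ') : Prf T Δ' A := by
  induction h with
  | ax h => exact ax h
  | hyp h => exact hyp (hΔ h)
  | impI _ ih => exact impI (ih (Set.insert_subset_insert hΔ))
  | impE _ _ ih ih' => exact impE (ih hΔ) (ih' hΔ)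
  | raa _ ih => exact raa (ih (Set.insert_subset_insert hΔ))
  | allI _ ih => exact allI (ih (Set.image_mono hΔ))
  | allE _ t ih => exact allE (ih hΔ) t

theorem subst (hT : T.SubstClosed) (h : Prf T Δ A) {W : Ctx} (u : ∀ σ, V σ → Tm W σ) :
    Prf T (Fm.subst u '' Δ) (A.subst u) := by
  induction h generalizing W with
  | ax h => exact ax (hT u h)
  | hyp h => exact hyp (Set.mem_image_of_mem _ h)
  | impI _ ih => exact impI (by simpa only [Set.image_insert_eq] using ih u)
  | impE _ _ ih ih' => exact impE (ih u) (ih' u)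
  | raa _ ih =>
    have := ih u
    rw [Set.image_insert_eq] at this
    exact raa this
  | allI _ ih =>
    refine allI ?_
    have := ih (liftSub u)
    rw [Set.image_image] at this ⊢
    simpa only [Fm.wk_subst] using this
  | allE _ t ih => rw [subst_inst]; exact allE (ih u) _

theorem of_bot (h : Prf T Δ bot) : Prf T Δ A :=
  raa (h.mono (Set.subset_insert _ _))

theorem cut (h : Prf T (insert A Δ) B) (h' : Prf T Δ A) : Prf T Δ B := impE (impI h) h'

end Prf

theorem substClosed_QFAC (σ τ : Ty) : Theory.SubstClosed (QFAC σ τ) := by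
  rintro V W u _ ⟨A, hA⟩
  have e : (A.subst choiceSub).subst (liftSub (liftSub u)) =
      (A.subst (liftSub (liftSub u))).subst choiceSub := by
    rw [Fm.subst_subst, Fm.subst_subst]
    congr 1
    funext ρ v
    rcases v with _ | (_ | v)
    · rfl
    · rfl
    · change (((u _ v).wk).wk) = (((u _ v).wk).wk).subst _
      simp only [Tm.wk_eq_subst, Tm.subst_subst]
      rfl
  have := QFAC.choice (A.subst (liftSub (liftSub u))) (hA.subst _)
  rw [← e] at this
  exact this

theorem substClosed_RCA0ω : Theory.SubstClosed RCA0ω := by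
  intro V W u A h
  induction h with
  | eq_refl => exact RCA0ω.eq_refl _
  | eq_symm => exact RCA0ω.eq_symm _ _
  | eq_trans => exact RCA0ω.eq_trans _ _ _
  | lt_congr => exact RCA0ω.lt_congr _ _ _ _
  | add_assoc => exact RCA0ω.add_assoc _ _ _
  | add_comm => exact RCA0ω.add_comm _ _
  | add_zero => exact RCA0ω.add_zero _
  | mul_assoc => exact RCA0ω.mul_assoc _ _ _
  | mul_comm => exact RCA0ω.mul_comm _ _
  | mul_one => exact RCA0ω.mul_one _
  | mul_zero => exact RCA0ω.mul_zero _
  | mul_add => exact RCA0ω.mul_add _ _ _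
  | lt_irrefl => exact RCA0ω.lt_irrefl _
  | lt_trans => exact RCA0ω.lt_trans _ _ _
  | lt_trichotomy => exact RCA0ω.lt_trichotomy _ _
  | add_lt_add => exact RCA0ω.add_lt_add _ _ _
  | mul_lt_mul => exact RCA0ω.mul_lt_mul _ _ _
  | not_lt_zero => exact RCA0ω.not_lt_zero _
  | lt_succ => exact RCA0ω.lt_succ _ _
  | K_def => rw [eqT_subst]; exact RCA0ω.K_def _ _
  | S_def => rw [eqT_subst]; exact RCA0ω.S_def _ _ _
  | R_zero => exact RCA0ω.R_zero _ _
  | R_succ => exact RCA0ω.R_succ _ _ _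
  | ext => rw [Fm.subst, eqT_subst, eqT_subst]; exact RCA0ω.ext _ _ _
  | ind A hA =>
    have e : (A.subst succSub).subst (liftSub u) = (A.subst (liftSub u)).subst succSub := by
      rw [Fm.subst_subst, Fm.subst_subst]
      congr 1
      funext ρ v
      rcases v with _ | v
      · rfl
      · change (u _ v).wk = ((u _ v).wk).subst _
        simp only [Tm.wk_eq_subst, Tm.subst_subst]
        rfl
    have := RCA0ω.ind (A.subst (liftSub u)) (hA.subst _)
    rw [← e, show (0 : Tm W t0) = (0 : Tm V t0).subst u from rfl, ← subst_inst] at this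
    exact this
  | qfac h => exact RCA0ω.qfac (substClosed_QFAC _ _ u h)

/-! ### There are countably many formulas over a countable context -/

def Ty.depth : Ty → ℕ
  | nat => 0
  | arr σ τ => max σ.depth τ.depth + 1

def Tm.depth {V : Ctx} : {σ : Ty} → Tm V σ → ℕ
  | _, var _ => 0
  | _, con _ => 0
  | _, app t s => max t.depth s.depth + 1

def Fm.depth : {V : Ctx} → Fm V → ℕ
  | _, bot => 0
  | _, eq _ _ => 0
  | _, lt _ _ => 0
  | _, imp A B => max A.depth B.depth + 1
  | _, all _ A => A.depth + 1

theorem countable_of_depth {α : Type*} (d : α → ℕ) (h : ∀ n, {a | d a ≤ n}.Countable) :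
    Countable α := by
  rw [← Set.countable_univ_iff]
  refine (Set.countable_iUnion h).mono fun a _ => Set.mem_iUnion.2 ⟨d a, le_refl (d a)⟩

instance : Countable Ty := by
  refine countable_of_depth Ty.depth fun n => ?_
  induction n with
  | zero =>
    refine (Set.countable_singleton nat).mono fun σ hσ => ?_
    cases σ with
    | nat => rfl
    | arr σ τ => exact absurd hσ (by simp [Ty.depth])
  | succ n ih =>
    refine ((ih.image2 ih arr).insert nat).mono fun σ hσ => ?_
    cases σ with
    | nat => exact Or.inl rfl
    | arr σ τ =>
      simp only [Set.mem_ofPred_eq, Ty.depth, Nat.add_le_add_iff_right, max_le_iff] at hσ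
      exact Or.inr ⟨σ, hσ.1, τ, hσ.2, rfl⟩

instance (σ : Ty) : Countable (Con σ) := by
  let F : Fin 4 ⊕ (Ty × Ty) ⊕ (Ty × Ty × Ty) ⊕ Ty → Σ σ, Con σ := fun x => match x with
    | .inl 0 => ⟨_, .zero⟩
    | .inl 1 => ⟨_, .one⟩
    | .inl 2 => ⟨_, .add⟩
    | .inl 3 => ⟨_, .mul⟩
    | .inr (.inl (σ, τ)) => ⟨_, .K σ τ⟩
    | .inr (.inr (.inl (ρ, σ, τ))) => ⟨_, .S ρ σ τ⟩
    | .inr (.inr (.inr σ)) => ⟨_, .R σ⟩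
  have hF : Function.Surjective F := by
    rintro ⟨_, c⟩
    cases c with
    | zero => exact ⟨.inl 0, rfl⟩
    | one => exact ⟨.inl 1, rfl⟩
    | add => exact ⟨.inl 2, rfl⟩
    | mul => exact ⟨.inl 3, rfl⟩
    | K σ τ => exact ⟨.inr (.inl (σ, τ)), rfl⟩
    | S ρ σ τ => exact ⟨.inr (.inr (.inl (ρ, σ, τ))), rfl⟩
    | R σ => exact ⟨.inr (.inr (.inr σ)), rfl⟩
  have := hF.countable
  exact (sigma_mk_injective (i := σ)).countable

instance {V : Ctx} [∀ σ, Countable (V σ)] (σ : Ty) : Countable (Tm V σ) := by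
  refine countable_of_depth Tm.depth fun n => ?_
  induction n generalizing σ with
  | zero =>
    refine ((Set.countable_range (var (V := V) (σ := σ))).union
      (Set.countable_range (con (V := V) (σ := σ)))).mono fun t ht => ?_
    cases t with
    | var v => exact Or.inl ⟨v, rfl⟩
    | con c => exact Or.inr ⟨c, rfl⟩
    | app t s => exact absurd ht (by simp [Tm.depth])
  | succ n ih =>
    refine (((Set.countable_range (var (V := V) (σ := σ))).union
      (Set.countable_range (con (V := V) (σ := σ)))).union
      (Set.countable_iUnion fun τ => (ih (τ ⇒ σ)).image2 (ih τ) app)).mono fun t ht => ?_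
    cases t with
    | var v => exact Or.inl (Or.inl ⟨v, rfl⟩)
    | con c => exact Or.inl (Or.inr ⟨c, rfl⟩)
    | app t s =>
      simp only [Set.mem_ofPred_eq, Tm.depth, Nat.add_le_add_iff_right, max_le_iff] at ht
      exact Or.inr (Set.mem_iUnion.2 ⟨_, t, ht.1, s, ht.2, rfl⟩)

instance {V : Ctx} [∀ σ, Countable (V σ)] (τ σ : Ty) : Countable ((V ▹ τ) σ) := by
  let F : (V ▹ τ) σ → Option (V σ) := fun v => match v with
    | .new => none
    | .old v => some v
  have hF : Function.Injective F := by
    intro v w h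
    cases v with
    | new => cases w with
      | new => rfl
      | old w => cases h
    | old v => cases w with
      | new => cases h
      | old w => cases h; rfl
  exact hF.countable

theorem countable_depth_le (n : ℕ) (V : Ctx) [∀ σ, Countable (V σ)] :
    {A : Fm V | A.depth ≤ n}.Countable := by
  induction n generalizing V with
  | zero =>
    refine (((Set.countable_range (Function.uncurry (Fm.eq (V := V)))).union
      (Set.countable_range (Function.uncurry (Fm.lt (V := V))))).insert bot).mono fun A hA => ?_
    cases A with
    | bot => exact Or.inl rfl
    | eq s t => exact Or.inr (Or.inl ⟨(s, t), rfl⟩)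
    | lt s t => exact Or.inr (Or.inr ⟨(s, t), rfl⟩)
    | imp A B => exact absurd hA (by simp [Fm.depth])
    | all σ A => exact absurd hA (by simp [Fm.depth])
  | succ n ih =>
    refine (((((Set.countable_range (Function.uncurry (Fm.eq (V := V)))).union
      (Set.countable_range (Function.uncurry (Fm.lt (V := V))))).insert bot).union
      ((ih V).image2 (ih V) imp)).union
      (Set.countable_iUnion fun σ => (ih (V ▹ σ)).image (all σ))).mono fun A hA => ?_
    cases A with
    | bot => exact Or.inl (Or.inl (Or.inl rfl))
    | eq s t => exact Or.inl (Or.inl (Or.inr (Or.inl ⟨(s, t), rfl⟩)))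
    | lt s t => exact Or.inl (Or.inl (Or.inr (Or.inr ⟨(s, t), rfl⟩)))
    | imp A B =>
      simp only [Set.mem_ofPred_eq, Fm.depth, Nat.add_le_add_iff_right, max_le_iff] at hA
      exact Or.inl (Or.inr ⟨A, hA.1, B, hA.2, rfl⟩)
    | all σ A =>
      simp only [Set.mem_ofPred_eq, Fm.depth, Nat.add_le_add_iff_right] at hA
      exact Or.inr (Set.mem_iUnion.2 ⟨σ, A, hA, rfl⟩)

instance {V : Ctx} [∀ σ, Countable (V σ)] : Countable (Fm V) :=
  countable_of_depth Fm.depth fun n => countable_depth_le n V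

/-! ### Structures and satisfaction -/

/-- An extensional structure for the language of all finite types, with `=₀` read as equality. -/
structure Model where
  El : Ty → Type
  app {σ τ : Ty} : El (σ ⇒ τ) → El σ → El τ
  con {σ : Ty} : Con σ → El σ
  lt : El t0 → El t0 → Prop
  ext {σ τ : Ty} (f g : El (σ ⇒ τ)) : (∀ x, app f x = app g x) → f = g

namespace Model

variable (M : Model) {V W : Ctx}

/-- The assignment `ρ`, extended by the value `x` of the new variable. -/
def push {τ : Ty} (ρ : ∀ σ, V σ → M.El σ) (x : M.El τ) : ∀ σ, (V ▹ τ) σ → M.El σ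
  | _, Ext.new => x
  | _, Ext.old v => ρ _ v

/-- The value of a term. -/
def eval (ρ : ∀ σ, V σ → M.El σ) : {σ : Ty} → Tm V σ → M.El σ
  | _, var v => ρ _ v
  | _, Tm.con c => M.con c
  | _, Tm.app t s => M.app (eval ρ t) (eval ρ s)

/-- Tarski's definition of truth. -/
def Sat : {V : Ctx} → (∀ σ, V σ → M.El σ) → Fm V → Prop
  | _, _, bot => False
  | _, ρ, eq s t => M.eval ρ s = M.eval ρ t
  | _, ρ, Fm.lt s t => M.lt (M.eval ρ s) (M.eval ρ t)
  | _, ρ, imp A B => Sat ρ A → Sat ρ B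
  | _, ρ, all _ A => ∀ x, Sat (M.push ρ x) A

end Model

/-! ### Completeness -/

/-- The context with countably many variables of every type. -/
abbrev Ctx.nat : Ctx := fun _ => ℕ

/-- A Henkin theory: maximally consistent, with a witness for every universal formula it
refutes. -/
structure IsHenkin (T : Theory) (H : Set (Fm Ctx.nat)) : Prop where
  ax {A : Fm Ctx.nat} : A ∈ T Ctx.nat → A ∈ H
  bot : Fm.bot ∉ H
  imp (A B : Fm Ctx.nat) : A.imp B ∈ H ↔ (A ∈ H → B ∈ H)
  all {σ : Ty} (A : Fm (Ctx.nat ▹ σ)) : Fm.all σ A ∈ H ↔ ∀ t, A.inst t ∈ H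

theorem Prf.allI_of_fresh {T : Theory} (hT : T.SubstClosed) {Γ : Set (Fm Ctx.nat)} {σ : Ty}
    {A : Fm (Ctx.nat ▹ σ)} {n : ℕ} (hΓ : ∀ B ∈ Γ, B.VarsIn fun _ k => k < n)
    (hA : A.VarsIn (liftPred fun _ k => k < n)) (h : Prf T Γ (A.inst (var n))) :
    Prf T Γ (Fm.all σ A) := by
  classical
  let u : ∀ τ, Ctx.nat τ → Tm (Ctx.nat ▹ σ) τ := fun τ k =>
    if k < n then var (Ext.old k) else if e : σ = τ then e ▸ var Ext.new else var (Ext.old k)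
  have hu : ∀ τ (k : ℕ), k < n → u τ k = var (Ext.old k) := fun τ k hk => if_pos hk
  have hn : u σ n = var Ext.new := by simp [u]
  have h' := h.subst hT u
  have e1 : Fm.subst u '' Γ = Fm.wk '' Γ := Set.image_congr fun B hB => by
    rw [Fm.wk_eq_subst]
    exact (hΓ B hB).subst_congr hu
  have e2 : (A.inst (var n)).subst u = A := by
    rw [Fm.inst, Fm.subst_subst]
    conv_rhs => rw [← A.subst_var]
    refine hA.subst_congr fun τ v hv => ?_
    cases v with
    | new => exact hn
    | old k => exact hu _ _ hv
  rw [e1, e2] at h'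
  exact Prf.allI h'

/-- A consistent set of formulas that leaves infinitely many variables unused. -/
def IsStage (T : Theory) (Γ : Set (Fm Ctx.nat)) : Prop :=
  (∃ n, ∀ B ∈ Γ, B.VarsIn fun _ k => k < n) ∧ ¬ Prf T Γ Fm.bot

theorem exists_bound_insert {Γ : Set (Fm Ctx.nat)} (B : Fm Ctx.nat)
    (h : ∃ n, ∀ B ∈ Γ, B.VarsIn fun _ k => k < n) :
    ∃ n, ∀ C ∈ insert B Γ, C.VarsIn fun _ k => k < n := by
  obtain ⟨m, hm⟩ := h
  obtain ⟨n, hn⟩ := B.exists_varsIn fun _ k => k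
  refine ⟨max m n, fun C hC => ?_⟩
  rcases hC with rfl | hC
  · exact hn.mono fun _ _ h => lt_max_of_lt_right h
  · exact (hm C hC).mono fun _ _ h => lt_max_of_lt_left h

theorem IsStage.exists_step {T : Theory} (hT : T.SubstClosed) {Γ : Set (Fm Ctx.nat)}
    (hΓ : IsStage T Γ) (B : Fm Ctx.nat) :
    ∃ Γ', IsStage T Γ' ∧ Γ ⊆ Γ' ∧ (B ∈ Γ' ∨ B.not ∈ Γ' ∧
      ∀ σ C, B = Fm.all σ C → ∃ t, (C.inst t).not ∈ Γ') := by
  obtain ⟨hb, hc⟩ := hΓ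
  by_cases hB : Prf T (insert B Γ) Fm.bot
  swap
  · exact ⟨_, ⟨exists_bound_insert B hb, hB⟩, Set.subset_insert _ _, Or.inl (Set.mem_insert _ _)⟩
  have hc' : ¬ Prf T (insert B.not Γ) Fm.bot := fun h => hc (Prf.cut hB (Prf.raa h))
  have hb' := exists_bound_insert B.not hb
  by_cases hall : ∃ σ C, B = Fm.all σ C
  · obtain ⟨σ, C, rfl⟩ := hall
    obtain ⟨n, hn⟩ := hb'
    have hC : C.VarsIn (liftPred fun _ k => k < n) := (hn _ (Set.mem_insert _ _)).1
    refine ⟨insert (C.inst (var n)).not (insert (Fm.all σ C).not Γ),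
      ⟨exists_bound_insert _ ⟨n, hn⟩, fun h => hc' ?_⟩,
      (Set.subset_insert _ _).trans (Set.subset_insert _ _),
      Or.inr ⟨Set.mem_insert_of_mem _ (Set.mem_insert _ _), ?_⟩⟩
    · exact Prf.impE (Prf.hyp (Set.mem_insert _ _)) (Prf.allI_of_fresh hT hn hC (Prf.raa h))
    · rintro _ _ ⟨⟩
      exact ⟨_, Set.mem_insert _ _⟩
  · exact ⟨_, ⟨hb', hc'⟩, Set.subset_insert _ _,
      Or.inr ⟨Set.mem_insert _ _, fun σ C h => (hall ⟨σ, C, h⟩).elim⟩⟩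

theorem IsStage.exists_isHenkin {T : Theory} (hT : T.SubstClosed) {Γ : Set (Fm Ctx.nat)}
    (hΓ : IsStage T Γ) : ∃ H, Γ ⊆ H ∧ IsHenkin T H := by
  have : Nonempty (Fm Ctx.nat) := ⟨Fm.bot⟩
  obtain ⟨e, he⟩ := exists_surjective_nat (Fm Ctx.nat)
  choose next hnext using fun (Γ : {Γ // IsStage T Γ}) (B : Fm Ctx.nat) =>
    Γ.2.exists_step hT B
  let G : ℕ → {Γ // IsStage T Γ} := fun n =>
    Nat.rec ⟨Γ, hΓ⟩ (fun n Γ => ⟨next Γ (e n), (hnext Γ (e n)).1⟩) n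
  have hsucc : ∀ n, (G (n + 1)).1 = next (G n) (e n) := fun n => rfl
  have hmono : Monotone fun n => (G n).1 :=
    monotone_nat_of_le_succ fun n => (hsucc n).symm ▸ (hnext (G n) (e n)).2.1
  have hdec : ∀ B, ∃ n, B ∈ (G n).1 ∨ B.not ∈ (G n).1 ∧
      ∀ σ C, B = Fm.all σ C → ∃ t, (C.inst t).not ∈ (G n).1 := by
    intro B
    obtain ⟨n, rfl⟩ := he B
    exact ⟨n + 1, by rw [hsucc]; exact (hnext (G n) (e n)).2.2⟩
  let H : Set (Fm Ctx.nat) := {B | ∃ n, Prf T (G n).1 B}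
  have hmem : ∀ {n B}, B ∈ (G n).1 → B ∈ H := fun h => ⟨_, Prf.hyp h⟩
  have hmp : ∀ {A B}, A.imp B ∈ H → A ∈ H → B ∈ H := by
    rintro A B ⟨m, hm⟩ ⟨n, hn⟩
    exact ⟨max m n, Prf.impE (hm.mono (hmono (le_max_left m n)))
      (hn.mono (hmono (le_max_right m n)))⟩
  have hbot : Fm.bot ∉ H := fun ⟨n, hn⟩ => (G n).2.2 hn
  have hnot : ∀ {B}, B ∉ H → B.not ∈ H ∧ ∀ σ C, B = Fm.all σ C → ∃ t, (C.inst t).not ∈ H := by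
    intro B hB
    obtain ⟨n, hn | ⟨hn, hn'⟩⟩ := hdec B
    · exact (hB (hmem hn)).elim
    · exact ⟨hmem hn, fun σ C h => (hn' σ C h).imp fun _ ht => hmem ht⟩
  refine ⟨H, fun B hB => hmem (n := 0) hB, ⟨fun h => ⟨0, Prf.ax h⟩, hbot, fun A B => ⟨hmp, ?_⟩,
    fun {σ} A => ⟨fun ⟨n, hn⟩ t => ⟨n, Prf.allE hn t⟩, fun h => ?_⟩⟩⟩
  · intro h
    by_cases hA : A ∈ H
    · obtain ⟨n, hn⟩ := h hA
      exact ⟨n, Prf.impI (hn.mono (Set.subset_insert _ _))⟩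
    · obtain ⟨n, hn⟩ := (hnot hA).1
      exact ⟨n, Prf.impI (Prf.of_bot (Prf.impE (hn.mono (Set.subset_insert _ _))
        (Prf.hyp (Set.mem_insert _ _))))⟩
  · by_contra hA
    obtain ⟨t, ht⟩ := (hnot hA).2 σ A rfl
    exact hbot (hmp ht (h t))

namespace IsHenkin

variable {T : Theory} {H : Set (Fm Ctx.nat)}

theorem eqT_arr (hH : IsHenkin T H) {σ τ : Ty} (s t : Tm Ctx.nat (σ ⇒ τ)) :
    eqT (σ ⇒ τ) s t ∈ H ↔ ∀ r, eqT τ (s ⬝ r) (t ⬝ r) ∈ H := by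
  rw [eqT, hH.all]
  refine forall_congr' fun r => ?_
  have hwk : ∀ t : Tm Ctx.nat (σ ⇒ τ), (t.wk : Tm (Ctx.nat ▹ σ) _).subst (instSub r) = t := by
    intro t
    rw [Tm.wk_eq_subst, Tm.subst_subst]
    exact t.subst_var
  rw [inst, eqT_subst, Tm.subst, Tm.subst, hwk, hwk]
  rfl

theorem eqT_refl (hT : ∀ V A, RCA0ω V A → A ∈ T V) (hH : IsHenkin T H) {τ : Ty}
    (s : Tm Ctx.nat τ) : eqT τ s s ∈ H := by
  induction τ with
  | nat => exact hH.ax (hT _ _ (RCA0ω.eq_refl s))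
  | arr σ τ _ ih => exact (hH.eqT_arr s s).2 fun r => ih _

theorem eqT_symm (hT : ∀ V A, RCA0ω V A → A ∈ T V) (hH : IsHenkin T H) {τ : Ty}
    {s t : Tm Ctx.nat τ} (h : eqT τ s t ∈ H) : eqT τ t s ∈ H := by
  induction τ with
  | nat => exact (hH.imp _ _).1 (hH.ax (hT _ _ (RCA0ω.eq_symm s t))) h
  | arr σ τ _ ih => exact (hH.eqT_arr t s).2 fun r => ih ((hH.eqT_arr s t).1 h r)

theorem eqT_trans (hT : ∀ V A, RCA0ω V A → A ∈ T V) (hH : IsHenkin T H) {τ : Ty}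
    {s t r : Tm Ctx.nat τ} (h : eqT τ s t ∈ H) (h' : eqT τ t r ∈ H) : eqT τ s r ∈ H := by
  induction τ with
  | nat =>
    exact (hH.imp _ _).1 ((hH.imp _ _).1 (hH.ax (hT _ _ (RCA0ω.eq_trans s t r))) h) h'
  | arr σ τ _ ih =>
    exact (hH.eqT_arr s r).2 fun x => ih ((hH.eqT_arr s t).1 h x) ((hH.eqT_arr t r).1 h' x)

theorem eqT_app (hT : ∀ V A, RCA0ω V A → A ∈ T V) (hH : IsHenkin T H) {σ τ : Ty}
    {s s' : Tm Ctx.nat (σ ⇒ τ)} {t t' : Tm Ctx.nat σ} (h : eqT (σ ⇒ τ) s s' ∈ H)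
    (h' : eqT σ t t' ∈ H) : eqT τ (s ⬝ t) (s' ⬝ t') ∈ H :=
  hH.eqT_trans hT ((hH.eqT_arr s s').1 h t)
    ((hH.imp _ _).1 (hH.ax (hT _ _ (RCA0ω.ext t t' s'))) h')

/-- Provable extensional equality of terms. -/
def setoid (hT : ∀ V A, RCA0ω V A → A ∈ T V) (hH : IsHenkin T H) (τ : Ty) :
    Setoid (Tm Ctx.nat τ) where
  r s t := eqT τ s t ∈ H
  iseqv := ⟨hH.eqT_refl hT, hH.eqT_symm hT, hH.eqT_trans hT⟩

theorem lt_congr (hT : ∀ V A, RCA0ω V A → A ∈ T V) (hH : IsHenkin T H)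
    {a b c d : Tm Ctx.nat t0} (h : eqT t0 a b ∈ H) (h' : eqT t0 c d ∈ H) (hl : (a <₀ c) ∈ H) :
    (b <₀ d) ∈ H :=
  (hH.imp _ _).1 ((hH.imp _ _).1 ((hH.imp _ _).1
    (hH.ax (hT _ _ (RCA0ω.lt_congr a b c d))) h) h') hl

/-- The term model. -/
def model (hT : ∀ V A, RCA0ω V A → A ∈ T V) (hH : IsHenkin T H) : Model where
  El τ := Quotient (hH.setoid hT τ)
  app := Quotient.map₂ Tm.app fun _ _ h _ _ h' => hH.eqT_app hT h h'
  con c := ⟦Tm.con c⟧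
  lt := Quotient.lift₂ (fun s t => (s <₀ t) ∈ H) fun _ _ _ _ h h' =>
    propext ⟨hH.lt_congr hT h h', hH.lt_congr hT (hH.eqT_symm hT h) (hH.eqT_symm hT h')⟩
  ext f g := Quotient.inductionOn₂ f g fun s t h =>
    Quotient.sound ((hH.eqT_arr s t).2 fun r => Quotient.exact (h ⟦r⟧))

/-- The element of the term model denoted by a term, and the assignment given by a
substitution. -/
def cls (hT : ∀ V A, RCA0ω V A → A ∈ T V) (hH : IsHenkin T H) {σ : Ty} (t : Tm Ctx.nat σ) :
    (hH.model hT).El σ := Quotient.mk (hH.setoid hT σ) t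

theorem cls_eq (hT : ∀ V A, RCA0ω V A → A ∈ T V) (hH : IsHenkin T H) {σ : Ty}
    {s t : Tm Ctx.nat σ} : hH.cls hT s = hH.cls hT t ↔ eqT σ s t ∈ H :=
  ⟨fun h => Quotient.exact (s := hH.setoid hT σ) h, fun h => Quotient.sound (s := hH.setoid hT σ) h⟩

theorem cls_surjective (hT : ∀ V A, RCA0ω V A → A ∈ T V) (hH : IsHenkin T H) {σ : Ty} :
    Function.Surjective (hH.cls hT (σ := σ)) := Quotient.exists_rep

theorem eval_model (hT : ∀ V A, RCA0ω V A → A ∈ T V) (hH : IsHenkin T H) {V : Ctx}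
    (u : ∀ σ, V σ → Tm Ctx.nat σ) {σ : Ty} (t : Tm V σ) :
    (hH.model hT).eval (fun τ v => hH.cls hT (u τ v)) t = hH.cls hT (t.subst u) := by
  induction t with
  | var v => rfl
  | con c => rfl
  | app t s iht ihs => rw [Model.eval, iht, ihs]; rfl

theorem sat_model (hT : ∀ V A, RCA0ω V A → A ∈ T V) (hH : IsHenkin T H) {V : Ctx} (A : Fm V)
    (u : ∀ σ, V σ → Tm Ctx.nat σ) :
    (hH.model hT).Sat (fun τ v => hH.cls hT (u τ v)) A ↔ A.subst u ∈ H := by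
  induction A with
  | bot => exact ⟨False.elim, fun h => hH.bot h⟩
  | eq s t =>
    rw [Model.Sat, eval_model, eval_model, cls_eq]
    rfl
  | lt s t =>
    rw [Model.Sat, eval_model, eval_model]
    rfl
  | imp A B ihA ihB => rw [Model.Sat, ihA, ihB, Fm.subst, hH.imp]
  | all σ A ih =>
    rw [Model.Sat, Fm.subst, hH.all, (hH.cls_surjective hT).forall]
    refine forall_congr' fun t => ?_
    rw [inst_subst_liftSub, ← ih]
    refine iff_of_eq (congrArg (fun ρ => (hH.model hT).Sat ρ A) ?_)
    funext τ v
    cases v <;> rfl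

end IsHenkin

/-- A model of the theory `T`. -/
def Model.Models (M : Model) (T : Theory) : Prop :=
  ∀ (V : Ctx) (A : Fm V), A ∈ T V → ∀ ρ, M.Sat ρ A

/-- A closed term of each type. -/
def Tm.closed {V : Ctx} : (σ : Ty) → Tm V σ
  | nat => 0
  | arr σ τ => con (Con.K τ σ) ⬝ closed τ

/-- Gödel's completeness theorem. -/
theorem Proves.of_models {T : Theory} (hS : T.SubstClosed) (hT : ∀ V A, RCA0ω V A → A ∈ T V)
    {A : Sentence} (h : ∀ M : Model, M.Models T → ∀ ρ, M.Sat ρ A) : Proves T A := by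
  by_contra hA
  let r : ∀ σ, Ctx.empty σ → Tm Ctx.nat σ := fun _ v => v.elim
  have hst : IsStage T {(A.subst r).not} := by
    refine ⟨?_, fun hp => hA ?_⟩
    · obtain ⟨n, hn⟩ := (A.subst r).not.exists_varsIn fun _ k => k
      exact ⟨n, fun B hB => hB ▸ hn⟩
    · have := (Prf.raa (Δ := ∅) (A := A.subst r) (hp.mono (by simp))).subst hS
        (W := Ctx.empty) fun σ _ => Tm.closed σ
      rw [Set.image_empty, Fm.subst_subst] at this
      have e : (fun σ v => (r σ v).subst fun σ _ => Tm.closed σ) =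
          fun σ (v : Ctx.empty σ) => Tm.var v := funext fun _ => funext fun v => v.elim
      rwa [e, A.subst_var] at this
  obtain ⟨H, hH, hHk⟩ := hst.exists_isHenkin hS
  have hM : (hHk.model hT).Models T := by
    intro V B hB ρ
    choose u hu using fun σ v => hHk.cls_surjective hT (ρ σ v)
    rw [← funext fun σ => funext fun v => hu σ v]
    exact (hHk.sat_model hT B u).2 (hHk.ax (hS u hB))
  exact hHk.bot ((hHk.imp _ _).1 (hH rfl)
    ((hHk.sat_model hT A r).1 (h _ hM _)))

/-! ### The arithmetic of a model -/

namespace Model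

section Satisfaction

variable (M : Model) {V W : Ctx}

theorem eval_subst (ρ : ∀ σ, W σ → M.El σ) (u : ∀ σ, V σ → Tm W σ) {σ : Ty} (t : Tm V σ) :
    M.eval ρ (t.subst u) = M.eval (fun σ v => M.eval ρ (u σ v)) t := by
  induction t with
  | var v => rfl
  | con c => rfl
  | app t s iht ihs => simp only [Tm.subst, eval, iht, ihs]

@[simp] theorem eval_wk (ρ : ∀ σ, V σ → M.El σ) {σ τ : Ty} (x : M.El τ) (t : Tm V σ) :
    M.eval (M.push ρ x) t.wk = M.eval ρ t := by
  rw [Tm.wk_eq_subst, eval_subst]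
  rfl

theorem sat_subst (ρ : ∀ σ, W σ → M.El σ) (u : ∀ σ, V σ → Tm W σ) (A : Fm V) :
    M.Sat ρ (A.subst u) ↔ M.Sat (fun σ v => M.eval ρ (u σ v)) A := by
  induction A generalizing W with
  | bot => rfl
  | eq s t => simp only [Fm.subst, Sat, eval_subst]
  | lt s t => simp only [Fm.subst, Sat, eval_subst]
  | imp A B ihA ihB => simp only [Fm.subst, Sat, ihA, ihB]
  | all σ A ih =>
    simp only [Fm.subst, Sat, ih]
    refine forall_congr' fun x => iff_of_eq (congrArg (fun ρ => M.Sat ρ A) ?_)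
    funext τ v
    cases v with
    | new => rfl
    | old v => exact M.eval_wk _ _ _

variable (ρ : ∀ σ, V σ → M.El σ)

@[simp] theorem sat_all {σ : Ty} (A : Fm (V ▹ σ)) :
    M.Sat ρ (Fm.all σ A) ↔ ∀ x, M.Sat (M.push ρ x) A := Iff.rfl

@[simp] theorem sat_imp (A B : Fm V) : M.Sat ρ (A.imp B) ↔ (M.Sat ρ A → M.Sat ρ B) := Iff.rfl

@[simp] theorem sat_eq (s t : Tm V t0) : M.Sat ρ (s =₀ t) ↔ M.eval ρ s = M.eval ρ t := Iff.rfl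

@[simp] theorem sat_lt (s t : Tm V t0) : M.Sat ρ (s <₀ t) ↔ M.lt (M.eval ρ s) (M.eval ρ t) :=
  Iff.rfl

@[simp] theorem sat_not (A : Fm V) : M.Sat ρ A.not ↔ ¬ M.Sat ρ A := Iff.rfl

@[simp] theorem sat_and (A B : Fm V) : M.Sat ρ (A.and B) ↔ M.Sat ρ A ∧ M.Sat ρ B := by
  simp [Fm.and]

@[simp] theorem sat_or (A B : Fm V) : M.Sat ρ (A.or B) ↔ M.Sat ρ A ∨ M.Sat ρ B := by
  simp [Fm.or, or_iff_not_imp_left]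

@[simp] theorem sat_iff (A B : Fm V) : M.Sat ρ (A.iff B) ↔ (M.Sat ρ A ↔ M.Sat ρ B) := by
  simp [Fm.iff, iff_def]

@[simp] theorem sat_ex {σ : Ty} (A : Fm (V ▹ σ)) :
    M.Sat ρ (Fm.ex σ A) ↔ ∃ x, M.Sat (M.push ρ x) A := by
  simp [Fm.ex]

@[simp] theorem sat_eqT (τ : Ty) {V : Ctx} (ρ : ∀ σ, V σ → M.El σ) (s t : Tm V τ) :
    M.Sat ρ (eqT τ s t) ↔ M.eval ρ s = M.eval ρ t := by
  induction τ generalizing V with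
  | nat => rfl
  | arr σ τ _ ih =>
    simp only [eqT, sat_all, ih, eval, eval_wk]
    exact ⟨fun h => M.ext _ _ h, fun h x => by rw [h]⟩

@[simp] theorem eval_app {σ τ : Ty} (t : Tm V (σ ⇒ τ)) (s : Tm V σ) :
    M.eval ρ (t ⬝ s) = M.app (M.eval ρ t) (M.eval ρ s) := rfl

@[simp] theorem eval_x0 {σ : Ty} (x : M.El σ) : M.eval (M.push ρ x) x0 = x := rfl

@[simp] theorem eval_x1 {σ τ : Ty} (x : M.El σ) (y : M.El τ) :
    M.eval (M.push (M.push ρ x) y) x1 = x := rfl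

@[simp] theorem eval_x2 {σ τ υ : Ty} (x : M.El σ) (y : M.El τ) (z : M.El υ) :
    M.eval (M.push (M.push (M.push ρ x) y) z) x2 = x := rfl

end Satisfaction

/-- The models of `RCA₀^ω`. -/
class RCA (M : Model) : Prop where
  sat : ∀ {V : Ctx} {A : Fm V}, RCA0ω V A → ∀ ρ, M.Sat ρ A

variable {M : Model}

instance {σ τ : Ty} : CoeFun (M.El (σ ⇒ τ)) fun _ => M.El σ → M.El τ := ⟨M.app⟩

instance : Zero (M.El t0) := ⟨M.con Con.zero⟩
instance : One (M.El t0) := ⟨M.con Con.one⟩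
instance : Add (M.El t0) := ⟨fun a b => M.app (M.app (M.con Con.add) a) b⟩
instance : Mul (M.El t0) := ⟨fun a b => M.app (M.app (M.con Con.mul) a) b⟩
instance : LT (M.El t0) := ⟨M.lt⟩

section

variable {V : Ctx} (ρ : ∀ σ, V σ → M.El σ)

@[simp] theorem eval_zero : M.eval ρ (0 : Tm V t0) = 0 := rfl
@[simp] theorem eval_one : M.eval ρ (1 : Tm V t0) = 1 := rfl
@[simp] theorem eval_add (s t : Tm V t0) : M.eval ρ (s + t) = M.eval ρ s + M.eval ρ t := rfl
@[simp] theorem lt_eq (a b : M.El t0) : M.lt a b ↔ a < b := Iff.rfl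

end

/-- The assignment that reads every element of the model as a name of itself. -/
abbrev self (M : Model) : ∀ σ, M.El σ → M.El σ := fun _ x => x

variable [M.RCA]

instance : CommSemiring (M.El t0) where
  add_assoc a b c := RCA.sat (RCA0ω.add_assoc (var a) (var b) (var c)) M.self
  add_comm a b := RCA.sat (RCA0ω.add_comm (var a) (var b)) M.self
  add_zero a := RCA.sat (RCA0ω.add_zero (var a)) M.self
  zero_add a := (RCA.sat (RCA0ω.add_comm 0 (var a)) M.self).trans
    (RCA.sat (RCA0ω.add_zero (var a)) M.self)
  mul_assoc a b c := RCA.sat (RCA0ω.mul_assoc (var a) (var b) (var c)) M.self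
  mul_comm a b := RCA.sat (RCA0ω.mul_comm (var a) (var b)) M.self
  mul_one a := RCA.sat (RCA0ω.mul_one (var a)) M.self
  one_mul a := (RCA.sat (RCA0ω.mul_comm 1 (var a)) M.self).trans
    (RCA.sat (RCA0ω.mul_one (var a)) M.self)
  mul_zero a := RCA.sat (RCA0ω.mul_zero (var a)) M.self
  zero_mul a := (RCA.sat (RCA0ω.mul_comm 0 (var a)) M.self).trans
    (RCA.sat (RCA0ω.mul_zero (var a)) M.self)
  left_distrib a b c := RCA.sat (RCA0ω.mul_add (var a) (var b) (var c)) M.self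
  nsmul := nsmulRec
  right_distrib a b c := by
    have comm : ∀ a b : M.El t0, a * b = b * a := fun a b =>
      RCA.sat (RCA0ω.mul_comm (var a) (var b)) M.self
    rw [comm, comm a, comm b]
    exact RCA.sat (RCA0ω.mul_add (var c) (var a) (var b)) M.self

theorem lt_irrefl' (a : M.El t0) : ¬ a < a := RCA.sat (RCA0ω.lt_irrefl (var a)) M.self

theorem lt_trans' {a b c : M.El t0} (h : a < b) (h' : b < c) : a < c :=
  RCA.sat (RCA0ω.lt_trans (var a) (var b) (var c)) M.self h h'

theorem lt_trichotomy' (a b : M.El t0) : a < b ∨ a = b ∨ b < a := by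
  have := RCA.sat (RCA0ω.lt_trichotomy (var a) (var b)) M.self
  simpa [eval] using this

noncomputable instance : LinearOrder (M.El t0) where
  le a b := a < b ∨ a = b
  lt a b := a < b
  le_refl a := Or.inr rfl
  le_trans a b c := by
    rintro (h | rfl) (h' | rfl)
    · exact Or.inl (lt_trans' h h')
    · exact Or.inl h
    · exact Or.inl h'
    · exact Or.inr rfl
  lt_iff_le_not_ge a b := by
    refine ⟨fun h => ⟨Or.inl h, ?_⟩, ?_⟩
    · rintro (h' | rfl)
      · exact lt_irrefl' _ (lt_trans' h h')
      · exact lt_irrefl' _ h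
    · rintro ⟨h | rfl, h'⟩
      · exact h
      · exact (h' (Or.inr rfl)).elim
  le_antisymm a b := by
    rintro (h | rfl) (h' | h')
    · exact (lt_irrefl' _ (lt_trans' h h')).elim
    · exact h'.symm
    · rfl
    · rfl
  le_total a b := by
    rcases lt_trichotomy' a b with h | h | h
    · exact Or.inl (Or.inl h)
    · exact Or.inl (Or.inr h)
    · exact Or.inr (Or.inl h)
  toDecidableLE := Classical.decRel _

theorem sat_le {V : Ctx} (ρ : ∀ σ, V σ → M.El σ) (s t : Tm V t0) :
    M.Sat ρ (Fm.le s t) ↔ M.eval ρ s ≤ M.eval ρ t := by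
  simp [Fm.le, le_iff_lt_or_eq]

theorem lt_add_one_iff' {a b : M.El t0} : a < b + 1 ↔ a ≤ b := by
  have := RCA.sat (RCA0ω.lt_succ (var a) (var b)) M.self
  rw [sat_iff, sat_le] at this
  exact this

theorem zero_le' (a : M.El t0) : 0 ≤ a :=
  not_lt.1 (RCA.sat (RCA0ω.not_lt_zero (var a)) M.self)

theorem add_lt_add_right'' {a b : M.El t0} (h : a < b) (c : M.El t0) : a + c < b + c :=
  RCA.sat (RCA0ω.add_lt_add (var a) (var b) (var c)) M.self h

instance : IsOrderedAddMonoid (M.El t0) where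
  add_le_add_left a b h c := by
    rcases h with h | rfl
    · exact (add_lt_add_right'' h c).le
    · exact le_rfl

instance : IsOrderedCancelAddMonoid (M.El t0) where
  le_of_add_le_add_left a b c h := by
    by_contra! hlt
    rw [add_comm a, add_comm a] at h
    exact absurd (add_lt_add_right'' hlt a) h.not_gt

instance : Nontrivial (M.El t0) := ⟨⟨0, 1, (lt_add_one_iff'.2 le_rfl |>.trans_eq (zero_add _)).ne⟩⟩

theorem mul_lt_mul_right'' {a b c : M.El t0} (hc : 0 < c) (h : a < b) : a * c < b * c :=
  RCA.sat (RCA0ω.mul_lt_mul (var a) (var b) (var c)) M.self hc h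

instance : IsStrictOrderedRing (M.El t0) where
  zero_le_one := zero_le' 1
  mul_lt_mul_of_pos_left a ha b c h := by
    simpa only [mul_comm a] using mul_lt_mul_right'' ha h
  mul_lt_mul_of_pos_right a ha b c h := mul_lt_mul_right'' ha h

/-! ### Induction, choice and the constants -/

theorem induction_of_qf (A : Fm (M.El ▹ t0)) (hA : A.QF) (h0 : M.Sat (M.push M.self 0) A)
    (hs : ∀ n : M.El t0, M.Sat (M.push M.self n) A → M.Sat (M.push M.self (n + 1)) A)
    (n : M.El t0) : M.Sat (M.push M.self n) A := by
  refine RCA.sat (RCA0ω.ind A hA) M.self ?_ ?_ n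
  · rw [inst, sat_subst]
    convert h0 using 1
    funext σ v
    cases v <;> rfl
  · intro n hn
    rw [sat_subst]
    convert hs n hn using 1
    funext σ v
    cases v <;> rfl

theorem exists_succ {c : M.El t0} (hc : c ≠ 0) : ∃ m, c = m + 1 := by
  by_contra! h
  refine lt_irrefl c (induction_of_qf (x0 <₀ var (Ext.old c)) trivial ?_ (fun n hn => ?_) c)
  · exact (zero_le' c).lt_of_ne hc.symm
  · exact lt_of_le_of_ne (not_lt.1 fun h' => (lt_add_one_iff'.1 h').not_gt hn) (h n).symm

theorem exists_add_of_le' {x y : M.El t0} (h : y ≤ x) : ∃ z, x = y + z := by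
  by_contra! h'
  have hx := induction_of_qf (Tm.con Con.add ⬝ var (Ext.old y) ⬝ x0 <₀ var (Ext.old x)) trivial
    (show y + 0 < x from lt_of_le_of_ne (by simpa using h) (h' 0).symm) (fun n hn => ?_) x
  · exact absurd (show y + x < x from hx) (not_lt.2 (le_add_of_nonneg_left (zero_le' y)))
  · have hn : y + n < x := hn
    refine lt_of_le_of_ne (not_lt.1 fun h'' => ?_) (h' (n + 1)).symm
    have h'' : x < y + n + 1 := by rw [_root_.add_assoc]; exact h''
    exact (lt_add_one_iff'.1 h'').not_gt hn

instance : CanonicallyOrderedAdd (M.El t0) where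
  exists_add_of_le h := exists_add_of_le' h
  le_add_self _ b := le_add_of_nonneg_left (zero_le' b)
  le_self_add _ b := le_add_of_nonneg_right (zero_le' b)

theorem K_app {σ τ : Ty} (x : M.El σ) (y : M.El τ) : (M.con (Con.K σ τ) : M.El _) x y = x :=
  (M.sat_eqT σ M.self _ _).1 (RCA.sat (RCA0ω.K_def (var x) (var y)) M.self)

theorem S_app {ρ σ τ : Ty} (x : M.El (ρ ⇒ σ ⇒ τ)) (y : M.El (ρ ⇒ σ)) (z : M.El ρ) :
    (M.con (Con.S ρ σ τ) : M.El _) x y z = x z (y z) :=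
  (M.sat_eqT τ M.self _ _).1 (RCA.sat (RCA0ω.S_def (var x) (var y) (var z)) M.self)

/-- The `n`-th iterate of `f` at `m`. -/
def iter (f : M.El t1) (m n : M.El t0) : M.El t0 := (M.con (Con.R t0) : M.El _) f m n

@[simp] theorem iter_zero (f : M.El t1) (m : M.El t0) : iter f m 0 = m :=
  RCA.sat (RCA0ω.R_zero (var f) (var m)) M.self

theorem iter_succ (f : M.El t1) (m n : M.El t0) : iter f m (n + 1) = f (iter f m n) :=
  RCA.sat (RCA0ω.R_succ (var f) (var m) (var n)) M.self

omit [M.RCA] in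
theorem choice_of_qf {σ τ : Ty} (hM : ∀ (A : Fm M.El), QFAC σ τ M.El A → M.Sat M.self A)
    (A : Fm (M.El ▹ σ ▹ τ)) (hA : A.QF)
    (h : ∀ x, ∃ y, M.Sat (M.push (M.push M.self x) y) A) :
    ∃ Y : M.El (σ ⇒ τ), ∀ x, M.Sat (M.push (M.push M.self x) (Y x)) A := by
  have := hM _ (QFAC.choice A hA)
  rw [sat_imp, sat_ex] at this
  obtain ⟨Y, hY⟩ := this (by simpa using h)
  refine ⟨Y, fun x => ?_⟩
  have := hY x
  rw [sat_subst] at this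
  convert this using 1
  funext ρ v
  rcases v with _ | (_ | v) <;> rfl

theorem qfac₁₀ (A : Fm M.El) (h : QFAC t1 t0 M.El A) : M.Sat M.self A :=
  RCA.sat (RCA0ω.qfac h) _

/-! ### Definable functions and decidable predicates -/

/-- Products of finitely many domains of the model, with the elements that name functions on
them. -/
class Env (M : Model) (Γ : Type) where
  arr : Ty → Ty
  ap {τ : Ty} : M.El (arr τ) → Γ → M.El τ
  const {τ : Ty} (x : M.El τ) : ∃ m, ∀ e, ap m e = x
  app {σ τ : Ty} (f : M.El (arr (σ ⇒ τ))) (g : M.El (arr σ)) :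
    ∃ m, ∀ e, ap m e = M.app (ap f e) (ap g e)

instance : Env M Unit where
  arr τ := τ
  ap m _ := m
  const x := ⟨x, fun _ => rfl⟩
  app f g := ⟨f g, fun _ => rfl⟩

instance {Γ : Type} [Env M Γ] {σ : Ty} : Env M (Γ × M.El σ) where
  arr τ := Env.arr M Γ (σ ⇒ τ)
  ap m p := (Env.ap m p.1) p.2
  const {τ} x := by
    obtain ⟨m, hm⟩ := Env.const (Γ := Γ) ((M.con (Con.K τ σ) : M.El _) x)
    exact ⟨m, fun e => by rw [hm, K_app]⟩
  app {σ' τ} f g := by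
    obtain ⟨s, hs⟩ := Env.const (Γ := Γ) (M.con (Con.S σ σ' τ))
    obtain ⟨s', hs'⟩ := Env.app s f
    obtain ⟨m, hm⟩ := Env.app s' g
    exact ⟨m, fun e => by rw [hm, hs', hs, S_app]⟩

variable {Γ : Type} [Env M Γ] {ρ σ τ υ : Ty}

/-- `F` is named by an element of the model. -/
class Rep (F : Γ → M.El τ) : Prop where
  out : ∃ m, ∀ e, Env.ap m e = F e

/-- The element that names `F`, if there is one. -/
noncomputable def lam (F : M.El σ → M.El τ) : M.El (σ ⇒ τ) := by
  classical
  exact if h : ∃ m : M.El (σ ⇒ τ), ∀ x, m x = F x then h.choose else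
    M.eval (V := M.El) M.self (Tm.closed _)

theorem lam_app (F : M.El σ → M.El τ) [h : Rep fun p : Unit × M.El σ => F p.2] (x : M.El σ) :
    lam F x = F x := by
  have h' : ∃ m : M.El (σ ⇒ τ), ∀ x, m x = F x := by
    obtain ⟨m, hm⟩ := h
    exact ⟨m, fun x => hm ((), x)⟩
  rw [lam, dif_pos h']
  exact h'.choose_spec x

namespace Rep

instance (priority := high) const (x : M.El τ) : Rep fun _ : Γ => x := ⟨Env.const x⟩

instance app (f : Γ → M.El (σ ⇒ τ)) (g : Γ → M.El σ) [hf : Rep f] [hg : Rep g] :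
    Rep fun e => (f e) (g e) := by
  obtain ⟨m, hm⟩ := hf
  obtain ⟨n, hn⟩ := hg
  obtain ⟨k, hk⟩ := Env.app m n
  exact ⟨k, fun e => by rw [hk, hm, hn]⟩

theorem wk {F : Γ → M.El τ} (hF : Rep F) : Rep fun p : Γ × M.El σ => F p.1 := by
  obtain ⟨m, hm⟩ := hF
  obtain ⟨n, hn⟩ := Env.const (Γ := Γ) (M.con (Con.K τ σ))
  obtain ⟨k, hk⟩ := Env.app n m
  exact ⟨k, fun e => by
    change (Env.ap k e.1) e.2 = _
    rw [hk, hn, K_app, hm]⟩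

instance (priority := high) v0 : Rep fun p : Γ × M.El σ => p.2 := by
  obtain ⟨k, hk⟩ := Env.const (Γ := Γ) ((M.con (Con.S σ (σ ⇒ σ) σ) : M.El _)
    (M.con (Con.K σ (σ ⇒ σ))) (M.con (Con.K σ σ)))
  exact ⟨k, fun e => by
    change (Env.ap k e.1) e.2 = _
    rw [hk, S_app, K_app]⟩

instance (priority := high) v1 : Rep fun p : (Γ × M.El σ) × M.El τ => p.1.2 := wk v0

instance (priority := high) v2 : Rep fun p : ((Γ × M.El ρ) × M.El σ) × M.El τ => p.1.1.2 :=
  wk v1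

instance (priority := high) v3 :
    Rep fun p : (((Γ × M.El υ) × M.El ρ) × M.El σ) × M.El τ => p.1.1.1.2 := wk v2

instance (priority := high) v4 {ω : Ty} :
    Rep fun p : ((((Γ × M.El ω) × M.El υ) × M.El ρ) × M.El σ) × M.El τ => p.1.1.1.1.2 := wk v3

theorem fix {F : Γ × M.El σ → M.El τ} (hF : Rep F) (e : Γ) :
    Rep fun p : Unit × M.El σ => F (e, p.2) := by
  obtain ⟨m, hm⟩ := hF
  exact ⟨(Env.ap m e : M.El (σ ⇒ τ)), fun p => hm (e, p.2)⟩

instance lam (F : Γ → M.El σ → M.El τ) [hF : Rep fun p : Γ × M.El σ => F p.1 p.2] :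
    Rep fun e => Model.lam (F e) := by
  obtain ⟨m, hm⟩ := hF
  refine ⟨m, fun e => M.ext _ _ fun x => ?_⟩
  have : Rep fun p : Unit × M.El σ => F e p.2 := fix ⟨m, hm⟩ e
  rw [lam_app]
  exact hm (e, x)

instance add (f g : Γ → M.El t0) [Rep f] [Rep g] : Rep fun e => f e + g e :=
  inferInstanceAs (Rep fun e => M.app (M.app (M.con Con.add) (f e)) (g e))

instance mul (f g : Γ → M.El t0) [Rep f] [Rep g] : Rep fun e => f e * g e :=
  inferInstanceAs (Rep fun e => M.app (M.app (M.con Con.mul) (f e)) (g e))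

instance iter (f : Γ → M.El t1) (g h : Γ → M.El t0) [Rep f] [Rep g] [Rep h] :
    Rep fun e => iter (f e) (g e) (h e) :=
  inferInstanceAs (Rep fun e => M.app (M.app (M.app (M.con (Con.R t0)) (f e)) (g e)) (h e))

end Rep

/-- The choice by cases `n = 0`, `n ≠ 0`. -/
def cases (x y n : M.El t0) : M.El t0 := iter ((M.con (Con.K t0 t0) : M.El _) y) x n

@[simp] theorem cases_zero (x y : M.El t0) : cases x y 0 = x := iter_zero _ _

theorem cases_ne_zero (x y : M.El t0) {n : M.El t0} (hn : n ≠ 0) : cases x y n = y := by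
  obtain ⟨m, rfl⟩ := exists_succ hn
  rw [cases, iter_succ, K_app]

@[simp] theorem cases_one (x y : M.El t0) : cases x y 1 = y := cases_ne_zero _ _ one_ne_zero

instance Rep.cases (f g h : Γ → M.El t0) [Rep f] [Rep g] [Rep h] :
    Rep fun e => cases (f e) (g e) (h e) :=
  inferInstanceAs (Rep fun e => Model.iter (M.app (M.con (Con.K t0 t0)) (g e)) (f e) (h e))

/-- `P` has a characteristic function that is named by an element of the model. -/
class Dec (M : Model) [M.RCA] {Γ : Type} [Env M Γ] (P : Γ → Prop) : Prop where
  out : ∃ c : Γ → M.El t0, Rep c ∧ ∀ e, P e ↔ c e = 0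

namespace Dec

theorem of_choice (P : M.El t0 → M.El t0 → Prop) (E : M.El t2)
    (hE : ∀ f : M.El t1, P (f 0) (f 1) ↔ E f = 0) (f g : Γ → M.El t0) [Rep f] [Rep g] :
    Dec M fun e => P (f e) (g e) := by
  refine ⟨_, (inferInstance : Rep fun e => E ((M.con (Con.R t0) : M.El _)
    ((M.con (Con.K t0 t0) : M.El _) (g e)) (f e))), fun e => ?_⟩
  rw [← hE]
  exact iff_of_eq (congrArg₂ P (cases_zero (f e) (g e)).symm (cases_one (f e) (g e)).symm)

instance eq (f g : Γ → M.El t0) [Rep f] [Rep g] : Dec M fun e => f e = g e := by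
  obtain ⟨E, hE⟩ := choice_of_qf qfac₁₀ (((x0 =₀ 0).and (x1 ⬝ 0 =₀ x1 ⬝ 1)).or
    ((x0 =₀ 1).and (x1 ⬝ 0 =₀ x1 ⬝ 1).not)) (by simp [Fm.and, Fm.or, Fm.not, Fm.QF])
    (by
      intro f
      by_cases h : f (0 : M.El t0) = f (1 : M.El t0)
      · exact ⟨(0 : M.El t0), by simp [h]⟩
      · exact ⟨(1 : M.El t0), by simp [h]⟩)
  refine of_choice _ E (fun f => ?_) f g
  have := hE f
  simp only [sat_or, sat_and, sat_eq, sat_not, eval_x0, eval_x1, eval_zero, eval_one, eval_app]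
    at this
  rcases this with ⟨h, h'⟩ | ⟨h, h'⟩
  · exact iff_of_true h' h
  · exact iff_of_false h' (by rw [h]; exact one_ne_zero)

instance lt (f g : Γ → M.El t0) [Rep f] [Rep g] : Dec M fun e => f e < g e := by
  obtain ⟨E, hE⟩ := choice_of_qf qfac₁₀ (((x0 =₀ 0).and (x1 ⬝ 0 <₀ x1 ⬝ 1)).or
    ((x0 =₀ 1).and (x1 ⬝ 0 <₀ x1 ⬝ 1).not)) (by simp [Fm.and, Fm.or, Fm.not, Fm.QF])
    (by
      intro f
      by_cases h : f (0 : M.El t0) < f (1 : M.El t0)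
      · exact ⟨(0 : M.El t0), by simp [h]⟩
      · exact ⟨(1 : M.El t0), by simp [h]⟩)
  refine of_choice _ E (fun f => ?_) f g
  have := hE f
  simp only [sat_or, sat_and, sat_eq, sat_lt, sat_not, eval_x0, eval_x1, eval_zero, eval_one,
    eval_app, lt_eq] at this
  rcases this with ⟨h, h'⟩ | ⟨h, h'⟩
  · exact iff_of_true h' h
  · exact iff_of_false h' (by rw [h]; exact one_ne_zero)

instance imp (P Q : Γ → Prop) [hP : Dec M P] [hQ : Dec M Q] : Dec M fun e => P e → Q e := by
  obtain ⟨c, _, hc⟩ := hP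
  obtain ⟨d, _, hd⟩ := hQ
  refine ⟨_, (inferInstance : Rep fun e => cases (d e) 0 (c e)), fun e => ?_⟩
  by_cases h : c e = 0
  · simp [hc, hd, h]
  · simp [hc, hd, h, cases_ne_zero]

instance (priority := high) const (p : Prop) : Dec M fun _ : Γ => p := by
  by_cases hp : p
  · exact ⟨fun _ => 0, inferInstance, fun _ => iff_of_true hp rfl⟩
  · exact ⟨fun _ => 1, inferInstance, fun _ => iff_of_false hp one_ne_zero⟩

theorem congr {P Q : Γ → Prop} (hP : Dec M P) (h : ∀ e, Q e ↔ P e) : Dec M Q := by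
  rwa [funext fun e => propext (h e)]

instance not (P : Γ → Prop) [Dec M P] : Dec M fun e => ¬ P e :=
  inferInstanceAs (Dec M fun e => P e → False)

instance and (P Q : Γ → Prop) [Dec M P] [Dec M Q] : Dec M fun e => P e ∧ Q e :=
  congr (inferInstance : Dec M fun e => ¬ (P e → ¬ Q e)) fun e => by tauto

instance or (P Q : Γ → Prop) [Dec M P] [Dec M Q] : Dec M fun e => P e ∨ Q e :=
  congr (inferInstance : Dec M fun e => ¬ P e → Q e) fun e => by tauto

instance iff (P Q : Γ → Prop) [Dec M P] [Dec M Q] : Dec M fun e => P e ↔ Q e :=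
  congr (inferInstance : Dec M fun e => (P e → Q e) ∧ (Q e → P e)) fun _ => iff_def

instance le (f g : Γ → M.El t0) [Rep f] [Rep g] : Dec M fun e => f e ≤ g e :=
  congr (inferInstance : Dec M fun e => ¬ g e < f e) fun _ => not_lt.symm

theorem wk {P : Γ → Prop} (hP : Dec M P) : Dec M fun p : Γ × M.El σ => P p.1 := by
  obtain ⟨c, hc, h⟩ := hP
  exact ⟨_, hc.wk, fun p => h p.1⟩

theorem fix {P : Γ × M.El σ → Prop} (hP : Dec M P) (e : Γ) :
    Dec M fun p : Unit × M.El σ => P (e, p.2) := by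
  obtain ⟨c, hc, h⟩ := hP
  exact ⟨_, hc.fix e, fun p => h (e, p.2)⟩

end Dec

open Classical in
instance Rep.ite (P : Γ → Prop) (f g : Γ → M.El t0) {i : ∀ e, Decidable (P e)} [hP : Dec M P]
    [Rep f] [Rep g] : Rep fun e => if P e then f e else g e := by
  obtain ⟨c, hc, h⟩ := hP
  have : (fun e => if P e then f e else g e) = fun e => Model.cases (f e) (g e) (c e) := by
    funext e
    by_cases he : P e
    · rw [if_pos he, (h e).1 he, cases_zero]
    · rw [if_neg he, cases_ne_zero _ _ fun h' => he ((h e).2 h')]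
  rw [this]
  infer_instance

/-- Induction for decidable predicates. -/
theorem induction {P : M.El t0 → Prop} [hP : Dec M fun p : Unit × M.El t0 => P p.2] (h0 : P 0)
    (hs : ∀ n, P n → P (n + 1)) (n : M.El t0) : P n := by
  obtain ⟨c, hc, h⟩ := hP
  have h' : ∀ x : M.El t0, P x ↔ (lam fun x : M.El t0 => c ((), x)) x = (0 : M.El t0) := fun x => by
    have : Rep fun p : Unit × M.El t0 => c ((), p.2) := hc
    rw [lam_app]
    exact h ((), x)
  simp only [h'] at h0 hs ⊢
  exact induction_of_qf (var (Ext.old (lam fun x : M.El t0 => c ((), x))) ⬝ x0 =₀ 0) trivial h0 hs n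

theorem choice (hM : ∀ (A : Fm M.El), QFAC σ t0 M.El A → M.Sat M.self A)
    (P : M.El σ → M.El t0 → Prop) [hP : Dec M fun p : (Unit × M.El σ) × M.El t0 => P p.1.2 p.2]
    (h : ∀ x, ∃ y, P x y) : ∃ Y : M.El (σ ⇒ t0), ∀ x, P x (Y x) := by
  obtain ⟨c, ⟨m, hm⟩, hc⟩ := hP
  have h' : ∀ x y, P x y ↔ M.app (σ := t0) (M.app (σ := σ) m x) y = (0 : M.El t0) := fun x y => by
    rw [hc (((), x), y), ← hm]
    rfl
  simp only [h'] at h ⊢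
  exact choice_of_qf hM (var (σ := σ ⇒ t0 ⇒ t0) (Ext.old (Ext.old m)) ⬝ x1 ⬝ x0 =₀ 0) trivial h

theorem choice₁₀ (P : M.El t1 → M.El t0 → Prop)
    [Dec M fun p : (Unit × M.El t1) × M.El t0 => P p.1.2 p.2] (h : ∀ x, ∃ y, P x y) :
    ∃ Y : M.El t2, ∀ x, P x (Y x) := choice qfac₁₀ P h

theorem choice₀₀ (P : M.El t0 → M.El t0 → Prop)
    [hP : Dec M fun p : (Unit × M.El t0) × M.El t0 => P p.1.2 p.2] (h : ∀ x, ∃ y, P x y) :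
    ∃ Y : M.El t1, ∀ x, P x (Y x) := by
  have : Dec M fun p : (Unit × M.El t1) × M.El t0 => P (p.1.2 (0 : M.El t0)) p.2 := by
    obtain ⟨c, ⟨m, hm⟩, hc⟩ := hP
    refine ⟨_, (inferInstance : Rep fun p : (Unit × M.El t1) × M.El t0 =>
      M.app (σ := t0) (M.app (σ := t0) m (p.1.2 (0 : M.El t0))) p.2), fun p => ?_⟩
    rw [hc (((), p.1.2 (0 : M.El t0)), p.2), ← hm]
    rfl
  obtain ⟨Y, hY⟩ := choice₁₀ (fun f n => P (f (0 : M.El t0)) n) fun f => h _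
  refine ⟨lam fun x => Y (lam fun _ => x), fun x => ?_⟩
  have := hY (lam fun _ => x)
  rwa [lam_app] at this ⊢

end Model

namespace Model

variable {M : Model} [M.RCA]

/-! ### Bounded search -/

theorem add_one_le_iff' {a b : M.El t0} : a + 1 ≤ b ↔ a < b := by
  rw [← not_lt, lt_add_one_iff', not_le]

theorem le_one_iff {a : M.El t0} : a ≤ 1 ↔ a = 0 ∨ a = 1 := by
  refine ⟨fun h => or_iff_not_imp_left.2 fun h0 => le_antisymm h ?_, ?_⟩
  · obtain ⟨m, rfl⟩ := exists_succ h0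
    exact le_add_of_nonneg_left (zero_le' m)
  · rintro (rfl | rfl)
    · exact zero_le' 1
    · exact le_rfl

theorem one_le_iff {a : M.El t0} : 1 ≤ a ↔ a ≠ 0 := by
  rw [← pos_iff_ne_zero, ← add_one_le_iff', zero_add]

variable {Γ : Type} [Env M Γ] {σ τ : Ty}

theorem Dec.comp (P : M.El σ → Prop) [hP : Dec M fun p : Unit × M.El σ => P p.2]
    (g : Γ → M.El σ) [hg : Rep g] : Dec M fun e => P (g e) := by
  obtain ⟨c, ⟨m, hm⟩, hc⟩ := hP
  refine ⟨_, Rep.app (M := M) (σ := σ) (τ := t0) (fun _ => m) g, fun e => ?_⟩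
  rw [hc ((), g e), ← hm]
  rfl

theorem Rep.comp (F : M.El σ → M.El τ) (hF : Rep fun p : Unit × M.El σ => F p.2)
    (g : Γ → M.El σ) [Rep g] : Rep fun e => F (g e) := by
  obtain ⟨m, hm⟩ := hF
  have : (fun e => F (g e)) = fun e => M.app (σ := σ) (τ := τ) m (g e) :=
    funext fun e => (hm ((), g e)).symm
  rw [this]
  infer_instance

theorem Rep.comp₂ {ρ : Ty} (F : M.El ρ → M.El σ → M.El τ)
    (hF : Rep fun p : (Unit × M.El ρ) × M.El σ => F p.1.2 p.2)
    (f : Γ → M.El ρ) (g : Γ → M.El σ) [Rep f] [Rep g] : Rep fun e => F (f e) (g e) := by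
  obtain ⟨m, hm⟩ := hF
  have : (fun e => F (f e) (g e)) =
      fun e => M.app (σ := σ) (τ := τ) (M.app (σ := ρ) m (f e)) (g e) :=
    funext fun e => (hm (((), f e), g e)).symm
  rw [this]
  infer_instance

open Classical in
/-- The least number below `n` that satisfies `P`, or else `n`. -/
noncomputable def mu (P : M.El t0 → Prop) (n : M.El t0) : M.El t0 :=
  iter (lam fun m : M.El t0 => if P m then m else m + 1) 0 n

instance Rep.mu (P : Γ → M.El t0 → Prop) (g : Γ → M.El t0)
    [Dec M fun p : Γ × M.El t0 => P p.1 p.2] [Rep g] : Rep fun e => mu (P e) (g e) := by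
  unfold Model.mu
  infer_instance

instance (priority := low) Rep.closed (F : M.El σ → M.El τ)
    [hF : Rep fun p : Unit × M.El σ => F p.2] : Rep fun p : Γ × M.El σ => F p.2 :=
  Rep.comp F hF fun p : Γ × M.El σ => p.2

instance (priority := low) Dec.closed (P : M.El σ → Prop)
    [hP : Dec M fun p : Unit × M.El σ => P p.2] : Dec M fun p : Γ × M.El σ => P p.2 :=
  Dec.comp P fun p : Γ × M.El σ => p.2

section mu

variable {P : M.El t0 → Prop} [hP : Dec M fun p : Unit × M.El t0 => P p.2]

omit hP in
theorem mu_zero : mu P 0 = 0 := iter_zero _ _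

theorem mu_succ_of_pos {n : M.El t0} (h : P (mu P n)) : mu P (n + 1) = mu P n := by
  rw [mu, iter_succ, ← mu, lam_app, if_pos h]

theorem mu_succ_of_neg {n : M.El t0} (h : ¬ P (mu P n)) : mu P (n + 1) = mu P n + 1 := by
  rw [mu, iter_succ, ← mu, lam_app, if_neg h]

theorem mu_le (n : M.El t0) : mu P n ≤ n := by
  refine induction (P := fun n => mu P n ≤ n) mu_zero.le (fun n ih => ?_) n
  · by_cases h : P (mu P n)
    · rw [mu_succ_of_pos h]
      exact ih.trans (le_add_of_nonneg_right (zero_le' 1))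
    · rw [mu_succ_of_neg h]
      gcongr

theorem mu_min {m : M.El t0} (hm : P m) (n : M.El t0) : mu P n ≤ m := by
  refine induction (P := fun n => mu P n ≤ m) (mu_zero.trans_le (zero_le' m)) (fun n ih => ?_) n
  · by_cases h : P (mu P n)
    · rwa [mu_succ_of_pos h]
    · rw [mu_succ_of_neg h, add_one_le_iff']
      exact ih.lt_of_ne fun e => h (e ▸ hm)

theorem mu_spec {n : M.El t0} (h : mu P n < n) : P (mu P n) := by
  have : Dec M fun p : Unit × M.El t0 => P (mu P p.2) := Dec.comp P _
  revert h
  refine induction (P := fun n => mu P n < n → P (mu P n))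
    (fun h => (h.not_ge (zero_le' _)).elim) (fun n ih h => ?_) n
  · by_cases h' : P (mu P n)
    · rwa [mu_succ_of_pos h']
    · rw [mu_succ_of_neg h'] at h
      exact (h' (ih (lt_of_add_lt_add_right h))).elim

theorem mu_eq {n m : M.El t0} (hm : P m) (h : ∀ k, P k → m ≤ k) (hn : m < n) : mu P n = m :=
  le_antisymm (mu_min hm n) (h _ (mu_spec ((mu_min hm n).trans_lt hn)))

/-- The least number principle for decidable predicates. -/
theorem exists_least (h : ∃ n, P n) : ∃ n, P n ∧ ∀ m, P m → n ≤ m := by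
  obtain ⟨n, hn⟩ := h
  exact ⟨mu P (n + 1), mu_spec (lt_add_one_iff'.2 (mu_min hn _)), fun m hm => mu_min hm _⟩

end mu

instance Dec.bex (P : Γ → M.El t0 → Prop) (g : Γ → M.El t0)
    [hP : Dec M fun p : Γ × M.El t0 => P p.1 p.2] [Rep g] :
    Dec M fun e => ∃ i, i < g e ∧ P e i := by
  refine congr (inferInstance : Dec M fun e => mu (P e) (g e) < g e) fun e => ?_
  have : Dec M fun p : Unit × M.El t0 => P e p.2 := hP.fix e
  exact ⟨fun ⟨i, hi, h⟩ => (mu_min h _).trans_lt hi, fun h => ⟨_, h, mu_spec h⟩⟩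

instance Dec.ball (P : Γ → M.El t0 → Prop) (g : Γ → M.El t0)
    [hP : Dec M fun p : Γ × M.El t0 => P p.1 p.2] [Rep g] :
    Dec M fun e => ∀ i, i < g e → P e i :=
  congr (inferInstance : Dec M fun e => ¬ ∃ i, i < g e ∧ ¬ P e i) fun e => by push Not; rfl

/-! ### Binary expansions -/

theorem double_inj {a b : M.El t0} (h : a + a = b + b) : a = b := by
  rcases lt_trichotomy a b with h' | h' | h'
  · exact absurd h (add_lt_add h' h').ne
  · exact h'
  · exact absurd h (add_lt_add h' h').ne'

theorem double_ne {a b : M.El t0} : a + a ≠ b + b + 1 := by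
  rcases lt_or_ge b a with h | h
  · refine (lt_of_lt_of_le ?_ (add_le_add (add_one_le_iff'.2 h) (add_one_le_iff'.2 h))).ne'
    rw [show b + 1 + (b + 1) = b + b + 1 + 1 by ring]
    exact lt_add_one _
  · exact ((add_le_add h h).trans_lt (lt_add_one _)).ne

theorem exists_half (n : M.El t0) : ∃ m, n = m + m ∨ n = m + m + 1 := by
  by_contra! h
  refine ((induction (P := fun m => m + m < n) ?_ (fun m ih => ?_) n).trans_le
    (le_add_of_nonneg_left (zero_le' n))).false
  · have := (h 0).1
    rw [add_zero] at *
    exact pos_iff_ne_zero.2 this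
  · have h1 := add_one_le_iff'.2 ((add_one_le_iff'.2 ih).lt_of_ne (h m).2.symm)
    have := (h (m + 1)).1
    rw [show m + 1 + (m + 1) = m + m + 1 + 1 by ring] at *
    exact h1.lt_of_ne this.symm

/-- The function `n ↦ ⌊n / 2⌋`. -/
noncomputable def half : M.El t1 :=
  (choice₀₀ (M := M) (fun n m => n = m + m ∨ n = m + m + 1) exists_half).choose

theorem half_spec (n : M.El t0) :
    n = (half : M.El t1) n + (half : M.El t1) n ∨ n = (half : M.El t1) n + (half : M.El t1) n + 1 :=
  (choice₀₀ (M := M) (fun n m => n = m + m ∨ n = m + m + 1) exists_half).choose_spec n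

theorem half_double (n : M.El t0) : (half : M.El t1) (n + n) = n := by
  rcases half_spec (n + n) with h | h
  · exact (double_inj h).symm
  · exact (double_ne h).elim

theorem half_double_add_one (n : M.El t0) : (half : M.El t1) (n + n + 1) = n := by
  rcases half_spec (n + n + 1) with h | h
  · exact (double_ne h.symm).elim
  · exact (double_inj (add_right_cancel h)).symm

theorem half_double_add (n : M.El t0) {b : M.El t0} (hb : b ≤ 1) :
    (half : M.El t1) (n + n + b) = n := by
  rcases le_one_iff.1 hb with rfl | rfl
  · rw [add_zero, half_double]
  · exact half_double_add_one n

theorem half_add_one_le {n : M.El t0} (h : 1 ≤ n) : (half : M.El t1) n + 1 ≤ n := by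
  rw [add_one_le_iff']
  set m := (half : M.El t1) n
  rcases half_spec n with h' | h'
  · rw [h']
    refine lt_add_of_pos_right _ (pos_iff_ne_zero.2 fun h0 => ?_)
    change m = 0 at h0
    change n = m + m at h'
    rw [h', h0, add_zero, one_le_iff] at h
    exact h rfl
  · rw [h']
    exact (le_add_of_nonneg_right (zero_le' m)).trans_lt (lt_add_one _)

theorem iter_succ' (f : M.El t1) (m n : M.El t0) : iter f m (n + 1) = iter f (f m) n := by
  refine induction (P := fun n => iter f m (n + 1) = iter f (f m) n) ?_ (fun n ih => ?_) n
  · rw [iter_succ, iter_zero, iter_zero]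
  · rw [iter_succ, ih, iter_succ]

theorem iter_half_add_le {t : M.El t0} (l : M.El t0) :
    1 ≤ iter half t l → iter half t l + l ≤ t := by
  refine induction (P := fun l => 1 ≤ iter half t l → iter half t l + l ≤ t) ?_
    (fun l ih h => ?_) l
  · intro
    rw [iter_zero, add_zero]
  · rw [iter_succ] at h ⊢
    have h1 : 1 ≤ iter half t l := by
      rw [one_le_iff] at h ⊢
      intro h0
      rw [h0] at h
      have := half_double (0 : M.El t0)
      rw [add_zero] at this
      exact h this
    refine le_trans ?_ (ih h1)
    rw [add_comm l 1, ← add_assoc]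
    exact add_le_add_left (half_add_one_le h1) l

/-- The length of the binary sequence with code `t`. -/
noncomputable def len (t : M.El t0) : M.El t0 := mu (fun l => iter half t l ≤ 1) t

instance Rep.len (f : Γ → M.El t0) [Rep f] : Rep fun e => len (f e) :=
  Rep.comp Model.len (by unfold Model.len; infer_instance) f

theorem iter_half_len (t : M.El t0) : iter half t (len t) ≤ 1 := by
  rcases (mu_le (P := fun l => iter half t l ≤ 1) t).lt_or_eq with h | h
  · exact mu_spec h
  · rw [len, h]
    by_contra! h1
    have h2 := iter_half_add_le t h1.le
    exact (lt_add_of_pos_left t (zero_lt_one.trans h1)).not_ge h2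

theorem len_le {t l : M.El t0} (h : iter half t l ≤ 1) : len t ≤ l := mu_min (P := fun l => iter half t l ≤ 1) h t

theorem len_one : len (1 : M.El t0) = 0 :=
  le_antisymm (len_le (by rw [iter_zero])) (zero_le' _)

theorem len_double_add {u b : M.El t0} (hu : 1 ≤ u) (hb : b ≤ 1) :
    len (u + u + b) = len u + 1 := by
  refine le_antisymm (len_le ?_) ?_
  · rw [iter_succ', half_double_add u hb]
    exact iter_half_len u
  · have h := iter_half_len (u + u + b)
    have h0 : len (u + u + b) ≠ 0 := by
      intro h0
      rw [h0, iter_zero] at h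
      have := ((add_le_add hu hu).trans (le_add_of_nonneg_right (zero_le' b))).trans h
      exact this.not_gt (lt_add_one 1)
    obtain ⟨m, hm⟩ := exists_succ h0
    rw [hm] at h ⊢
    rw [iter_succ', half_double_add u hb] at h
    exact add_le_add_left (len_le h) 1

open Classical in
/-- The binary sequence with code `t`, continued by zeros. -/
noncomputable def fn (t : M.El t0) : M.El t1 := lam fun i : M.El t0 =>
  if ∃ j, j < len t ∧ (len (iter half t (j + 1)) = i ∧
    iter half t j = iter half t (j + 1) + iter half t (j + 1) + 1) then 1 else 0

instance Rep.fn (f : Γ → M.El t0) [Rep f] : Rep fun e => fn (f e) :=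
  Rep.comp Model.fn (by unfold Model.fn; infer_instance) f

theorem fn_le_one (t i : M.El t0) : fn t i ≤ (1 : M.El t0) := by
  rw [fn, lam_app]
  split_ifs
  · exact le_rfl
  · exact zero_le' 1

theorem fn_eq_one_iff (t i : M.El t0) : fn t i = (1 : M.El t0) ↔
    ∃ j, j < len t ∧ (len (iter half t (j + 1)) = i ∧
      iter half t j = iter half t (j + 1) + iter half t (j + 1) + 1) := by
  rw [fn, lam_app]
  split_ifs with h
  · exact iff_of_true rfl h
  · exact iff_of_false zero_ne_one h

theorem fn_double_add {u b : M.El t0} (hu : 1 ≤ u) (hb : b ≤ 1) (i : M.El t0) :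
    fn (u + u + b) i = (1 : M.El t0) ↔ (len u = i ∧ b = 1) ∨ fn u i = (1 : M.El t0) := by
  rw [fn_eq_one_iff, fn_eq_one_iff, len_double_add hu hb]
  constructor
  · rintro ⟨j, hj, h, h'⟩
    by_cases h0 : j = 0
    · subst h0
      rw [iter_succ', half_double_add u hb, iter_zero] at h
      rw [iter_succ', half_double_add u hb, iter_zero, iter_zero] at h'
      exact Or.inl ⟨h, add_left_cancel h'⟩
    · obtain ⟨m, rfl⟩ := exists_succ h0
      rw [iter_succ', half_double_add u hb] at h
      rw [iter_succ', half_double_add u hb, iter_succ', half_double_add u hb] at h'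
      exact Or.inr ⟨m, lt_of_add_lt_add_right hj, h, h'⟩
  · rintro (⟨h, rfl⟩ | ⟨m, hm, h, h'⟩)
    · refine ⟨0, lt_add_one_iff'.2 (zero_le' _), ?_⟩
      rw [iter_succ', half_double_add u hb, iter_zero, iter_zero]
      exact ⟨h, rfl⟩
    · refine ⟨m + 1, add_lt_add_left hm 1, ?_⟩
      rw [iter_succ' half (u + u + b), iter_succ' half (u + u + b), half_double_add u hb]
      exact ⟨h, h'⟩

theorem fn_one (i : M.El t0) : fn 1 i = (0 : M.El t0) := by
  refine (le_one_iff.1 (fn_le_one 1 i)).resolve_right fun h => ?_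
  obtain ⟨j, hj, -⟩ := (fn_eq_one_iff 1 i).1 h
  rw [len_one] at hj
  exact hj.not_ge (zero_le' j)

/-- The code of the initial segment of `b` of length `n`. -/
noncomputable def seg (b : M.El t1) (n : M.El t0) : M.El t0 :=
  iter (lam fun t : M.El t0 => t + t + b (len t)) 1 n

instance Rep.seg (b : Γ → M.El t1) (n : Γ → M.El t0) [Rep b] [Rep n] :
    Rep fun e => seg (b e) (n e) :=
  Rep.comp₂ Model.seg (by unfold Model.seg; infer_instance) b n

theorem seg_zero (b : M.El t1) : seg b 0 = 1 := iter_zero _ _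

section seg

variable {b : M.El t1} (hb : ∀ i : M.El t0, b i ≤ (1 : M.El t0))

theorem seg_succ' (b : M.El t1) (n : M.El t0) :
    seg b (n + 1) = seg b n + seg b n + b (len (seg b n)) := by
  rw [seg, iter_succ, ← seg, lam_app]

include hb

theorem one_le_seg_and (n : M.El t0) : 1 ≤ seg b n ∧ len (seg b n) = n := by
  refine induction (P := fun n => 1 ≤ seg b n ∧ len (seg b n) = n) ?_ (fun n ih => ?_) n
  · rw [seg_zero]
    exact ⟨le_rfl, len_one⟩
  · rw [seg_succ', len_double_add ih.1 (hb _), ih.2]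
    refine ⟨(ih.1.trans (le_add_of_nonneg_right (zero_le' _))).trans
      (le_add_of_nonneg_right (zero_le' _)), rfl⟩

theorem one_le_seg (n : M.El t0) : 1 ≤ seg b n := (one_le_seg_and hb n).1

theorem len_seg (n : M.El t0) : len (seg b n) = n := (one_le_seg_and hb n).2

theorem seg_succ (n : M.El t0) : seg b (n + 1) = seg b n + seg b n + b n := by
  rw [seg_succ', len_seg hb]

theorem lt_seg (n : M.El t0) : n < seg b n := by
  refine induction (P := fun n => n < seg b n) ?_ (fun n ih => ?_) n
  · rw [seg_zero]
    exact zero_lt_one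
  · rw [seg_succ hb]
    exact (add_lt_add_of_lt_of_le ih (one_le_seg hb n)).trans_le
      (le_add_of_nonneg_right (zero_le' _))

theorem fn_seg (n i : M.El t0) :
    fn (seg b n) i = (1 : M.El t0) ↔ i < n ∧ b i = (1 : M.El t0) := by
  refine induction (P := fun n => fn (seg b n) i = (1 : M.El t0) ↔ i < n ∧ b i = (1 : M.El t0))
    ?_ (fun n ih => ?_) n
  · rw [seg_zero, fn_one]
    exact iff_of_false zero_ne_one fun h => h.1.not_ge (zero_le' i)
  · rw [seg_succ hb, fn_double_add (one_le_seg hb n) (hb n), ih, len_seg hb, lt_add_one_iff',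
      le_iff_lt_or_eq]
    constructor
    · rintro (⟨rfl, h⟩ | ⟨h, h'⟩)
      · exact ⟨Or.inr rfl, h⟩
      · exact ⟨Or.inl h, h'⟩
    · rintro ⟨h | rfl, h'⟩
      · exact Or.inr ⟨h, h'⟩
      · exact Or.inl ⟨rfl, h'⟩

theorem fn_seg_of_lt {n i : M.El t0} (h : i < n) : fn (seg b n) i = (b i : M.El t0) := by
  have := fn_seg hb n i
  rcases le_one_iff.1 (hb i) with h0 | h1
  · rw [h0]
    refine (le_one_iff.1 (fn_le_one _ _)).resolve_right fun h1 => ?_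
    exact zero_ne_one (h0.symm.trans (this.1 h1).2)
  · rw [h1]
    exact this.2 ⟨h, h1⟩

theorem iter_half_seg (k j : M.El t0) : iter half (seg b (k + j)) j = seg b k := by
  refine induction (P := fun j => iter half (seg b (k + j)) j = seg b k) ?_ (fun j ih => ?_) j
  · rw [add_zero, iter_zero]
  · rw [iter_succ', ← add_assoc, seg_succ hb, half_double_add _ (hb _), ih]

theorem seg_lt (n : M.El t0) :
    seg b n < iter (lam fun x : M.El t0 => x + x) (1 + 1) n := by
  refine induction (P := fun n => seg b n < iter (lam fun x : M.El t0 => x + x) (1 + 1) n)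
    ?_ (fun n ih => ?_) n
  · rw [seg_zero, iter_zero]
    exact lt_add_one 1
  · rw [iter_succ, lam_app, seg_succ hb, ← add_one_le_iff']
    rw [← add_one_le_iff'] at ih
    refine le_trans ?_ (add_le_add ih ih)
    rw [show seg b n + 1 + (seg b n + 1) = seg b n + seg b n + 1 + 1 by ring]
    gcongr
    exact hb n

end seg

end Model

namespace Model

variable {M : Model} [M.RCA] {Γ : Type} [Env M Γ] {ρ σ τ : Ty}

/-! ### Semantics of the sentences -/

/-- `f ∈ C`. -/
def InC (f : M.El t1) : Prop := ∀ i : M.El t0, f i ≤ (1 : M.El t0)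

/-- The initial segments of length `N` agree. -/
def Agree (f g : M.El t1) (N : M.El t0) : Prop := ∀ i : M.El t0, i < N → f i = (g i : M.El t0)

/-- `Y` is continuous on Baire space. -/
def Cont (Y : M.El t2) : Prop := ∀ f, ∃ N, ∀ g, Agree f g N → Y f = (Y g : M.El t0)

/-- `N` is a modulus of uniform continuity of `Y` on Cantor space. -/
def UnifC (Y : M.El t2) (N : M.El t0) : Prop :=
  ∀ f, InC f → ∀ g, InC g → Agree f g N → Y f = (Y g : M.El t0)

section

variable {V : Ctx} (ρ : ∀ σ, V σ → M.El σ)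

theorem sat_inC (f : Tm V t1) : M.Sat ρ (inC f) ↔ InC (M.eval ρ f) := by
  simp [inC, InC, sat_le]

omit [M.RCA] in
theorem sat_agree (f g : Tm V t1) (N : Tm V t0) :
    M.Sat ρ (agree f g N) ↔ Agree (M.eval ρ f) (M.eval ρ g) (M.eval ρ N) := by
  simp [agree, Agree]

omit [M.RCA] in
theorem sat_cont (Y : Tm V t2) : M.Sat ρ (cont Y) ↔ Cont (M.eval ρ Y) := by
  simp [cont, Cont, sat_agree]

theorem sat_unifC (Y : Tm V t2) (N : Tm V t0) :
    M.Sat ρ (unifC Y N) ↔ UnifC (M.eval ρ Y) (M.eval ρ N) := by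
  simp only [unifC, UnifC, sat_all, sat_imp, sat_inC, sat_agree, sat_eq, eval_app, eval_wk,
    eval_x0, eval_x1]
  exact forall_congr' fun f => ⟨fun h hf g hg => h g hf hg, fun h g hf hg => h hf g hg⟩

end

/-- `(κ₀³)`, `(Z³)`, `FF` and `(∃²)` in a model. -/
class HasKappa (M : Model) [M.RCA] : Prop where
  out : ∃ κ : M.El t3, ∀ Y : M.El t2, κ Y = (0 : M.El t0) ↔ ∃ f, InC f ∧ (0 : M.El t0) < Y f

class HasZ (M : Model) [M.RCA] : Prop where
  out : ∃ Z : M.El t3, ∀ Y : M.El t2, Z Y = (0 : M.El t0) ↔ Cont Y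

class HasFF (M : Model) [M.RCA] : Prop where
  out : ∃ Φ : M.El t3, ∀ Y : M.El t2, Cont Y → UnifC Y (Φ Y)

class HasE2 (M : Model) [M.RCA] : Prop where
  out : ∃ E : M.El t2, ∀ f : M.El t1, E f = (0 : M.El t0) ↔ ∃ n : M.El t0, f n = (0 : M.El t0)

theorem sat_kappa0 {V : Ctx} (ρ : ∀ σ, V σ → M.El σ) : M.Sat ρ kappa0 ↔ M.HasKappa := by
  simp only [kappa0, sat_ex, sat_all, sat_iff, sat_eq, sat_and, sat_lt, sat_inC, eval_app,
    eval_x0, eval_x1, eval_zero]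
  exact ⟨fun h => ⟨h⟩, fun h => h.out⟩

theorem sat_Z3 {V : Ctx} (ρ : ∀ σ, V σ → M.El σ) : M.Sat ρ Z3 ↔ M.HasZ := by
  simp only [Z3, sat_ex, sat_all, sat_iff, sat_eq, sat_cont, eval_app, eval_x0, eval_x1,
    eval_zero]
  exact ⟨fun h => ⟨h⟩, fun h => h.out⟩

theorem sat_FF {V : Ctx} (ρ : ∀ σ, V σ → M.El σ) : M.Sat ρ FF ↔ M.HasFF := by
  simp only [FF, sat_ex, sat_all, sat_imp, sat_unifC, sat_cont, eval_app, eval_x0, eval_x1]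
  exact ⟨fun h => ⟨h⟩, fun h => h.out⟩

theorem exists_path {V : Ctx} {ρ : ∀ σ, V σ → M.El σ} (hM : M.Sat ρ WKL) (T : M.El t1)
    (hT : ∀ u : M.El t0, 1 ≤ u → T (u + u) = (0 : M.El t0) ∨ T (u + u + 1) = (0 : M.El t0) →
      T u = (0 : M.El t0))
    (hinf : ∀ n : M.El t0, ∃ t : M.El t0, n < t ∧ T t = (0 : M.El t0)) :
    ∃ b : M.El t1, InC b ∧ ∀ n : M.El t0, T (seg b n) = (0 : M.El t0) := by
  simp only [WKL, isTree, isInfinite, isPath, isSegments, sat_all, sat_imp, sat_and, sat_ex,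
    sat_or, sat_eq, sat_lt, sat_le, sat_inC, eval_app, eval_add, eval_zero, eval_one, eval_x0,
    eval_x1, eval_wk] at hM
  obtain ⟨b, hb, g, ⟨hg0, hg⟩, h⟩ := hM T ⟨hT, hinf⟩
  refine ⟨b, hb, fun n => ?_⟩
  have : g n = seg b n := by
    refine induction (P := fun n => g n = seg b n) ?_ (fun n ih => ?_) n
    · rw [seg_zero]
      exact hg0
    · rw [seg_succ hb, ← ih]
      exact hg n
  rw [← this]
  exact h n

/-! ### Quantifiers over infinite domains -/

theorem Dec.inst {P : Γ → M.El σ → Prop} (hP : Dec M fun p : Γ × M.El σ => P p.1 p.2)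
    (G : Γ × M.El ρ → M.El σ) [Rep G] : Dec M fun p : Γ × M.El ρ => P p.1 (G p) := by
  obtain ⟨c, ⟨m, hm⟩, hc⟩ := hP
  have : Rep fun e : Γ => Env.ap (τ := σ ⇒ t0) m e := ⟨m, fun _ => rfl⟩
  have := this.wk (σ := ρ)
  refine ⟨_, (inferInstance : Rep fun p : Γ × M.El ρ =>
    M.app (τ := t0) (Env.ap (τ := σ ⇒ t0) m p.1) (G p)), fun p => ?_⟩
  rw [hc (p.1, G p), ← hm]
  rfl

instance Dec.exNat [HasE2 M] (P : Γ → M.El t0 → Prop)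
    [hP : Dec M fun p : Γ × M.El t0 => P p.1 p.2] : Dec M fun e => ∃ n, P e n := by
  classical
  obtain ⟨E, hE⟩ := HasE2.out (M := M)
  refine ⟨_, (inferInstance : Rep fun e => E (lam fun n : M.El t0 => if P e n then 0 else 1)),
    fun e => ?_⟩
  have : Dec M fun p : Unit × M.El t0 => P e p.2 := hP.fix e
  rw [hE]
  refine exists_congr fun n => ?_
  rw [lam_app]
  split_ifs with h
  · exact iff_of_true h rfl
  · exact iff_of_false h one_ne_zero

instance Dec.allNat [HasE2 M] (P : Γ → M.El t0 → Prop)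
    [hP : Dec M fun p : Γ × M.El t0 => P p.1 p.2] : Dec M fun e => ∀ n, P e n :=
  congr (inferInstance : Dec M fun e => ¬ ∃ n, ¬ P e n) fun e => by push Not; rfl

instance Dec.exC [HasKappa M] (P : Γ → M.El t1 → Prop)
    [hP : Dec M fun p : Γ × M.El t1 => P p.1 p.2] : Dec M fun e => ∃ f, InC f ∧ P e f := by
  classical
  obtain ⟨κ, hκ⟩ := HasKappa.out (M := M)
  refine ⟨_, (inferInstance : Rep fun e => κ (lam fun f : M.El t1 =>
    if P e f then (1 : M.El t0) else 0)), fun e => ?_⟩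
  have : Dec M fun p : Unit × M.El t1 => P e p.2 := hP.fix e
  rw [hκ]
  refine exists_congr fun f => and_congr_right fun _ => ?_
  rw [lam_app]
  split_ifs with h
  · exact iff_of_true h zero_lt_one
  · exact iff_of_false h (lt_irrefl _)

instance Dec.allC [HasKappa M] (P : Γ → M.El t1 → Prop)
    [hP : Dec M fun p : Γ × M.El t1 => P p.1 p.2] : Dec M fun e => ∀ f, InC f → P e f :=
  congr (inferInstance : Dec M fun e => ¬ ∃ f, InC f ∧ ¬ P e f) fun e => by push Not; rfl

instance Dec.agree (f g : Γ → M.El t1) (N : Γ → M.El t0)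
    [hf : Rep f] [hg : Rep g] [Rep N] : Dec M fun e => Agree (f e) (g e) (N e) := by
  have := hf.wk (σ := t0)
  have := hg.wk (σ := t0)
  unfold Agree
  infer_instance

/-! ### Pairs of numbers -/

/-- An injective pairing function. -/
def pr (n m : M.El t0) : M.El t0 := (n + m) * (n + m) + n

instance Rep.pr (f g : Γ → M.El t0) [Rep f] [Rep g] : Rep fun e => pr (f e) (g e) := by
  unfold Model.pr
  infer_instance

theorem sum_le_of_pr_eq {n m n' m' : M.El t0} (h : pr n m = pr n' m') : n + m ≤ n' + m' := by
  by_contra! hlt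
  rw [← add_one_le_iff'] at hlt
  have h1 : (n' + m' + 1) * (n' + m' + 1) ≤ pr n m :=
    (mul_le_mul hlt hlt (zero_le' _) (zero_le' _)).trans (le_add_of_nonneg_right (zero_le' n))
  rw [h, pr] at h1
  refine h1.not_gt ?_
  rw [show (n' + m' + 1) * (n' + m' + 1) =
    (n' + m') * (n' + m') + n' + (m' + (n' + m') + 1) by ring]
  exact lt_add_of_pos_right _ (add_pos_of_nonneg_of_pos (zero_le' _) zero_lt_one)

theorem pr_inj {n m n' m' : M.El t0} (h : pr n m = pr n' m') : n = n' ∧ m = m' := by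
  have hs := le_antisymm (sum_le_of_pr_eq h) (sum_le_of_pr_eq h.symm)
  rw [pr, pr, hs] at h
  have hn := add_left_cancel h
  rw [hn] at hs
  exact ⟨hn, add_left_cancel hs⟩

theorem left_le_pr (n m : M.El t0) : n ≤ pr n m := le_add_of_nonneg_left (zero_le' _)

theorem right_le_pr (n m : M.El t0) : m ≤ pr n m := by
  refine le_trans ?_ (le_add_of_nonneg_right (zero_le' n))
  refine (le_add_of_nonneg_left (zero_le' n) : m ≤ n + m).trans ?_
  rcases eq_or_ne (n + m) 0 with h | h
  · rw [h]
    exact zero_le' _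
  · exact le_mul_of_one_le_left (zero_le' _) (one_le_iff.2 h)

open Classical in
/-- The characteristic function of the graph of `g`. -/
noncomputable def graph (g : M.El t1) : M.El t1 := lam fun z : M.El t0 =>
  if ∃ n, n < z + 1 ∧ z = pr n (g n) then (1 : M.El t0) else 0

theorem graph_inC (g : M.El t1) : InC (graph g) := fun z => by
  rw [graph, lam_app]
  split_ifs
  · exact le_rfl
  · exact zero_le' 1

theorem graph_pr (g : M.El t1) (n m : M.El t0) :
    graph g (pr n m) = (1 : M.El t0) ↔ m = (g n : M.El t0) := by
  rw [graph, lam_app]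
  split_ifs with h
  · refine iff_of_true rfl ?_
    obtain ⟨k, -, hk⟩ := h
    obtain ⟨rfl, h⟩ := pr_inj hk
    exact h
  · refine iff_of_false zero_ne_one ?_
    rintro rfl
    exact h ⟨n, lt_add_one_iff'.2 (left_le_pr _ _), rfl⟩

theorem exists_bound (h : M.El t1) (k : M.El t0) :
    ∃ L : M.El t0, ∀ n : M.El t0, n < k → h n < L := by
  have : ∃ j, j < k + 1 ∧ ∀ i, i < k + 1 → h i ≤ (h j : M.El t0) := by
    refine induction (P := fun k => ∃ j, j < k + 1 ∧ ∀ i, i < k + 1 → h i ≤ (h j : M.El t0))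
      ⟨0, lt_add_one 0, fun i hi => ?_⟩ (fun k ih => ?_) k
    · rw [le_antisymm (lt_add_one_iff'.1 hi) (zero_le' i)]
    · obtain ⟨j, hj, h'⟩ := ih
      rcases le_total (h j) (h (k + 1) : M.El t0) with hl | hl
      · refine ⟨k + 1, lt_add_one _, fun i hi => ?_⟩
        rcases (lt_add_one_iff'.1 hi).lt_or_eq with hi | rfl
        · exact (h' i hi).trans hl
        · exact le_rfl
      · refine ⟨j, hj.trans (lt_add_one _), fun i hi => ?_⟩
        rcases (lt_add_one_iff'.1 hi).lt_or_eq with hi | rfl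
        · exact h' i hi
        · exact hl
  obtain ⟨j, -, hj⟩ := this
  exact ⟨h j + 1, fun n hn => lt_add_one_iff'.2 (hj n (hn.trans (lt_add_one k)))⟩

/-- The sequence, dense in Baire space, of the functions whose graphs are coded by `fn t`. -/
noncomputable def dense (t : M.El t0) : M.El t1 := lam fun n : M.El t0 =>
  mu (fun m => fn t (pr n m) = (1 : M.El t0)) t

instance Rep.dense (f : Γ → M.El t0) [Rep f] : Rep fun e => dense (f e) :=
  Rep.comp Model.dense (by unfold Model.dense; infer_instance) f

theorem exists_dense (g : M.El t1) (k : M.El t0) : ∃ t, Agree g (dense t) k := by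
  obtain ⟨L, hL⟩ := exists_bound (lam fun n : M.El t0 => pr n (g n)) k
  refine ⟨seg (graph g) L, fun n hn => ?_⟩
  have hn' := hL n hn
  rw [lam_app] at hn'
  have hfn := fun m => fn_seg (graph_inC g) L (pr n m)
  simp only [graph_pr] at hfn
  rw [dense, lam_app]
  refine (mu_eq (P := fun m => fn (seg (graph g) L) (pr n m) = (1 : M.El t0))
    ((hfn _).2 ⟨hn', rfl⟩) (fun m hm => ((hfn m).1 hm).2.ge) ?_).symm
  exact ((right_le_pr _ _).trans_lt hn').trans (lt_seg (graph_inC g) L)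

/-! ### Grilliot's trick -/

theorem hasE2_of_ne (Y : M.El t2) (f : M.El t1) (g : M.El (t0 ⇒ t1))
    (hg : ∀ n, Agree f (g n) n) (hY : ∀ n : M.El t0, Y f ≠ (Y (g n) : M.El t0)) : HasE2 M := by
  classical
  let J : M.El t1 → M.El t1 := fun h => lam fun k : M.El t0 =>
    if ∃ m, m < k + 1 ∧ h m = (0 : M.El t0) then
      (g (mu (fun m => h m = (0 : M.El t0)) (k + 1))) k else (f k : M.El t0)
  have hJ : ∀ h : M.El t1, ∀ k : M.El t0, J h k = if ∃ m, m < k + 1 ∧ h m = (0 : M.El t0) then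
      (g (mu (fun m => h m = (0 : M.El t0)) (k + 1))) k else (f k : M.El t0) :=
    fun h k => lam_app _ k
  refine ⟨lam fun h : M.El t1 => if Y (J h) = (Y f : M.El t0) then (1 : M.El t0) else 0,
    fun h => ?_⟩
  rw [lam_app]
  by_cases hex : ∃ n : M.El t0, h n = (0 : M.El t0)
  · obtain ⟨n, hn, hmin⟩ := exists_least hex
    have : J h = g n := M.ext _ _ fun k => by
      rw [hJ]
      split_ifs with hk
      · obtain ⟨m, hm, hm'⟩ := hk
        rw [mu_eq (P := fun n => h n = (0 : M.El t0)) hn hmin ((hmin m hm').trans_lt hm)]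
      · exact hg n k (not_le.1 fun hle => hk ⟨n, lt_add_one_iff'.2 hle, hn⟩)
    rw [this, if_neg (hY n).symm]
    exact iff_of_true rfl hex
  · have : J h = f := M.ext _ _ fun k => by
      rw [hJ, if_neg fun ⟨m, _, hm⟩ => hex ⟨m, hm⟩]
    rw [this, if_pos rfl]
    exact iff_of_false one_ne_zero hex

theorem cont_of_not_hasE2 (h : ¬ HasE2 M) (Y : M.El t2) : Cont Y := by
  by_contra hY
  unfold Cont at hY
  push Not at hY
  obtain ⟨f, hf⟩ := hY
  have seqcont : ∀ (f : M.El t1) (g : M.El (t0 ⇒ t1)), (∀ n, Agree f (g n) n) →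
      ∃ n : M.El t0, Y f = (Y (g n) : M.El t0) := by
    intro f g hg
    by_contra! hne
    exact h (hasE2_of_ne Y f g hg hne)
  have key : ∀ N, ∃ t, Agree f (dense t) N ∧ Y f ≠ (Y (dense t) : M.El t0) := by
    intro N
    obtain ⟨g, hg, hne⟩ := hf N
    obtain ⟨s, hs⟩ := choice₀₀ (M := M) (fun k t => Agree g (dense t) (k + N))
      fun k => exists_dense g (k + N)
    obtain ⟨n, hn⟩ := seqcont g (lam fun k : M.El t0 => dense (s k)) fun k i hi => by
      rw [lam_app]
      exact hs k i (hi.trans_le (le_add_of_nonneg_right (zero_le' N)))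
    rw [lam_app] at hn
    refine ⟨s n, fun i hi => (hg i hi).trans (hs n i ?_), hn ▸ hne⟩
    exact hi.trans_le (le_add_of_nonneg_left (zero_le' n))
  obtain ⟨s, hs⟩ := choice₀₀ (M := M)
    (fun N t => Agree f (dense t) N ∧ Y f ≠ (Y (dense t) : M.El t0)) key
  obtain ⟨n, hn⟩ := seqcont f (lam fun k : M.El t0 => dense (s k)) fun k => by
    rw [lam_app]
    exact (hs k).1
  rw [lam_app] at hn
  exact (hs n).2 hn

end Model

namespace Model

variable {M : Model} [M.RCA] {Γ : Type} [Env M Γ] {ρ σ τ : Ty}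

/-! ### From `κ₀` to `Z` and `FF` -/

theorem exists_search [HasE2 M] : ∃ μ : M.El t2, ∀ (h : M.El t1) (k : M.El t0),
    h k = (1 : M.El t0) → h (μ h) = (1 : M.El t0) := by
  obtain ⟨μ, hμ⟩ := choice₁₀ (M := M)
    (fun h m => (∃ k : M.El t0, h k = (1 : M.El t0)) → h m = (1 : M.El t0)) fun h => by
      by_cases hk : ∃ k : M.El t0, h k = (1 : M.El t0)
      · exact hk.imp fun k hk _ => hk
      · exact ⟨0, fun h => (hk h).elim⟩
  exact ⟨μ, fun h k hk => hμ h ⟨k, hk⟩⟩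

instance Dec.exFun [HasKappa M] [HasE2 M] (P : Γ → M.El t1 → Prop)
    [hP : Dec M fun p : Γ × M.El t1 => P p.1 p.2] : Dec M fun e => ∃ f, P e f := by
  obtain ⟨μ, hμ⟩ := exists_search (M := M)
  let d : M.El t1 → M.El t1 := fun h => lam fun n : M.El t0 => μ (lam fun m : M.El t0 => h (pr n m))
  have : Dec M fun p : Γ × M.El t1 => P p.1 (d p.2) := hP.inst fun p => d p.2
  refine congr (inferInstance : Dec M fun e => ∃ h, InC h ∧ P e (d h)) fun e => ?_
  refine ⟨fun ⟨f, hf⟩ => ⟨graph f, graph_inC f, ?_⟩, fun ⟨h, _, hh⟩ => ⟨d h, hh⟩⟩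
  have : d (graph f) = f := M.ext _ _ fun n => by
    have h1 := hμ (lam fun m : M.El t0 => graph f (pr n m)) (f n) (by
      rw [lam_app, graph_pr])
    rw [lam_app, graph_pr] at h1
    change (lam _ : M.El t1) n = _
    rw [lam_app, h1]
  rwa [this]

instance Dec.allFun [HasKappa M] [HasE2 M] (P : Γ → M.El t1 → Prop)
    [hP : Dec M fun p : Γ × M.El t1 => P p.1 p.2] : Dec M fun e => ∀ f, P e f :=
  congr (inferInstance : Dec M fun e => ¬ ∃ f, ¬ P e f) fun e => by push Not; rfl

theorem HasKappa.hasZ [HasKappa M] : HasZ M := by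
  classical
  by_cases hE : HasE2 M
  · have : Dec M fun p : Unit × M.El t2 => Cont p.2 := by
      unfold Cont
      infer_instance
    refine ⟨lam fun Y : M.El t2 => if Cont Y then (0 : M.El t0) else 1, fun Y => ?_⟩
    rw [lam_app]
    split_ifs with h
    · exact iff_of_true rfl h
    · exact iff_of_false one_ne_zero h
  · refine ⟨lam fun _ : M.El t2 => (0 : M.El t0), fun Y => ?_⟩
    rw [lam_app]
    exact iff_of_true rfl (cont_of_not_hasE2 hE Y)

theorem exists_least_modulus [HasKappa M] {Y : M.El t2} (hY : Cont Y) : ∃ G : M.El t2,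
    ∀ f, InC f → (∀ g, InC g → Agree f g (G f) → Y f = (Y g : M.El t0)) ∧
      ∀ N, (∀ g, InC g → Agree f g N → Y f = (Y g : M.El t0)) → G f ≤ N := by
  classical
  let c : M.El t1 → M.El t1 := fun f => lam fun i : M.El t0 =>
    if f i = (0 : M.El t0) then (0 : M.El t0) else 1
  have hc : ∀ f, InC f → c f = f := fun f hf => M.ext _ _ fun i => by
    change (lam _ : M.El t1) i = _
    rw [lam_app]
    split_ifs with h
    · exact h.symm
    · exact ((le_one_iff.1 (hf i)).resolve_left h).symm
  let P : M.El t1 → M.El t0 → Prop := fun f N =>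
    ∀ g, InC g → Agree (c f) g N → Y (c f) = (Y g : M.El t0)
  have hP : Dec M fun p : (Unit × M.El t1) × M.El t0 => P p.1.2 p.2 := inferInstanceAs
    (Dec M fun p : (Unit × M.El t1) × M.El t0 =>
      ∀ g, InC g → Agree (c p.1.2) g p.2 → Y (c p.1.2) = (Y g : M.El t0))
  have hP' : Dec M fun p : ((Unit × M.El t1) × M.El t0) × M.El t0 => P p.1.1.2 p.2 :=
    inferInstanceAs (Dec M fun p : ((Unit × M.El t1) × M.El t0) × M.El t0 =>
      ∀ g, InC g → Agree (c p.1.1.2) g p.2 → Y (c p.1.1.2) = (Y g : M.El t0))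
  obtain ⟨G, hG⟩ := choice₁₀ (M := M) (fun f N => P f N ∧ ∀ K, K < N → ¬ P f K) fun f => by
    have : Dec M fun p : Unit × M.El t0 => P f p.2 := hP.fix ((), f)
    obtain ⟨N, hN⟩ := hY (c f)
    obtain ⟨N, hN, hmin⟩ := exists_least (P := P f) ⟨N, fun g _ hg => hN g hg⟩
    exact ⟨N, hN, fun K hK hPK => hK.not_ge (hmin K hPK)⟩
  refine ⟨G, fun f hf => ?_⟩
  have := hG f
  simp only [P, hc f hf] at this
  exact ⟨this.1, fun N hN => not_lt.1 fun h => this.2 N h hN⟩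

omit [M.RCA] in
theorem Agree.symm {f g : M.El t1} {N : M.El t0} (h : Agree f g N) : Agree g f N :=
  fun i hi => (h i hi).symm

omit [M.RCA] in
theorem Agree.trans {f g h : M.El t1} {N : M.El t0} (h₁ : Agree f g N) (h₂ : Agree g h N) :
    Agree f h N := fun i hi => (h₁ i hi).trans (h₂ i hi)

theorem Agree.mono {f g : M.El t1} {N K : M.El t0} (h : Agree f g N) (hK : K ≤ N) :
    Agree f g K := fun i hi => h i (hi.trans_le hK)

theorem fn_seg_agree {b : M.El t1} (hb : InC b) (n : M.El t0) : Agree b (fn (seg b n)) n :=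
  fun _ hi => (fn_seg_of_lt hb hi).symm

theorem exists_unifC [HasKappa M] {V : Ctx} {ρ : ∀ σ, V σ → M.El σ} (hM : M.Sat ρ WKL)
    {Y : M.El t2} (hY : Cont Y) : ∃ N, UnifC Y N := by
  classical
  obtain ⟨G, hG⟩ := exists_least_modulus hY
  let T : M.El t1 := lam fun t : M.El t0 => if ∀ j, j < len t + 1 →
    len (iter half t j) < G (fn (iter half t j)) then (0 : M.El t0) else 1
  have hT : ∀ t : M.El t0, T t = (0 : M.El t0) ↔
      ∀ j, j < len t + 1 → len (iter half t j) < (G (fn (iter half t j)) : M.El t0) := fun t => by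
    change (lam _ : M.El t1) t = _ ↔ _
    rw [lam_app]
    split_ifs with h
    · exact iff_of_true rfl h
    · exact iff_of_false one_ne_zero h
  have htree : ∀ u : M.El t0, 1 ≤ u → ∀ b : M.El t0, b ≤ 1 → T (u + u + b) = (0 : M.El t0) →
      T u = (0 : M.El t0) := fun u hu b hb h => by
    rw [hT] at h ⊢
    intro j hj
    have := h (j + 1) (by
      rw [len_double_add hu hb]
      exact add_lt_add_left hj 1)
    rwa [iter_succ', half_double_add u hb] at this
  have hfin : ∃ n : M.El t0, ∀ t : M.El t0, n < t → T t ≠ (0 : M.El t0) := by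
    by_contra! hinf
    obtain ⟨b, hb, hpath⟩ := exists_path hM T (fun u hu h => by
      rcases h with h | h
      · exact htree u hu 0 (zero_le' 1) (by rwa [add_zero])
      · exact htree u hu 1 le_rfl h) hinf
    have h1 := (hT _).1 (hpath (G b)) 0 (lt_add_one_iff'.2 (zero_le' _))
    rw [iter_zero, len_seg hb] at h1
    have hag := fn_seg_agree hb (G b)
    refine h1.not_ge ((hG _ (fn_le_one _)).2 _ fun g hg h => ?_)
    rw [← (hG b hb).1 _ (fn_le_one _) hag]
    exact (hG b hb).1 g hg (hag.trans h)
  obtain ⟨n, hn⟩ := hfin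
  refine ⟨n, fun f hf g hg hfg => ?_⟩
  have h1 := hn _ (lt_seg hf n)
  rw [Ne, hT, len_seg hf] at h1
  push Not at h1
  obtain ⟨j, hj, h1⟩ := h1
  obtain ⟨k, rfl⟩ := exists_add_of_le' (lt_add_one_iff'.1 hj)
  rw [add_comm j k] at h1 hfg
  rw [iter_half_seg hf, len_seg hf] at h1
  have hag := fn_seg_agree hf k
  have hfg' := hfg.mono (le_add_of_nonneg_right (zero_le' j))
  have hmod := (hG _ (fn_le_one (seg f k))).1
  rw [← hmod f hf (hag.symm.mono h1), ← hmod g hg ((hag.symm.trans hfg').mono h1)]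

theorem HasKappa.hasFF [HasKappa M] [HasZ M] {V : Ctx} {ρ : ∀ σ, V σ → M.El σ}
    (hM : M.Sat ρ WKL) (hC : ∀ A : Fm M.El, QFAC t2 t0 M.El A → M.Sat M.self A) : HasFF M := by
  obtain ⟨Z, hZ⟩ := HasZ.out (M := M)
  have : Dec M fun p : (Unit × M.El t2) × M.El t0 => UnifC p.1.2 p.2 := by
    unfold UnifC
    infer_instance
  obtain ⟨Φ, hΦ⟩ := choice hC (fun Y N => Z Y = (0 : M.El t0) → UnifC Y N) fun Y => by
    by_cases hY : Cont Y
    · exact (exists_unifC hM hY).imp fun N hN _ => hN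
    · exact ⟨0, fun h => (hY ((hZ Y).1 h)).elim⟩
  exact ⟨Φ, fun Y hY => hΦ Y ((hZ Y).2 hY)⟩

/-! ### From `Z` and `FF` to `κ₀` -/

theorem hasKappa_of_not_hasE2 [HasFF M] (hE : ¬ HasE2 M) : HasKappa M := by
  classical
  obtain ⟨Φ, hΦ⟩ := HasFF.out (M := M)
  refine ⟨lam fun Y : M.El t2 => if ∃ t, t < iter (lam fun x : M.El t0 => x + x) (1 + 1) (Φ Y) ∧
    0 < (Y (fn t) : M.El t0) then (0 : M.El t0) else 1, fun Y => ?_⟩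
  rw [lam_app]
  have hiff : (∃ t, t < iter (lam fun x : M.El t0 => x + x) (1 + 1) (Φ Y) ∧
      0 < (Y (fn t) : M.El t0)) ↔ ∃ f, InC f ∧ (0 : M.El t0) < Y f := by
    refine ⟨fun ⟨t, _, ht⟩ => ⟨fn t, fn_le_one t, ht⟩, fun ⟨f, hf, h⟩ => ?_⟩
    refine ⟨seg f (Φ Y), seg_lt hf _, ?_⟩
    rwa [← hΦ Y (cont_of_not_hasE2 hE Y) f hf _ (fn_le_one _) (fn_seg_agree hf _)]
  rw [← hiff]
  split_ifs with h
  · exact iff_of_true rfl h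
  · exact iff_of_false one_ne_zero h

theorem hasKappa_of_hasE2 [HasZ M] [HasE2 M] : HasKappa M := by
  classical
  obtain ⟨Z, hZ⟩ := HasZ.out (M := M)
  let p : M.El t1 → M.El t1 := fun h => lam fun n : M.El t0 =>
    if h n = (half : M.El t1) (h n) + (half : M.El t1) (h n) then (0 : M.El t0) else 1
  have hp : ∀ (h : M.El t1) (n : M.El t0), p h n =
      if h n = (half : M.El t1) (h n) + (half : M.El t1) (h n) then (0 : M.El t0) else 1 :=
    fun h n => lam_app _ n
  have hpC : ∀ h, InC (p h) := fun h n => by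
    rw [hp]
    split_ifs
    · exact zero_le' 1
    · exact le_rfl
  let F : M.El t2 → M.El t2 := fun Y => lam fun h : M.El t1 =>
    if 0 < (Y (p h) : M.El t0) ∧ ∃ n : M.El t0, 1 < (h n : M.El t0) then (1 : M.El t0) else 0
  have hF : ∀ (Y : M.El t2) (h : M.El t1), F Y h =
      if 0 < (Y (p h) : M.El t0) ∧ ∃ n : M.El t0, 1 < (h n : M.El t0) then (1 : M.El t0) else 0 :=
    fun Y h => lam_app _ h
  refine ⟨lam fun Y : M.El t2 => if Z (F Y) = (0 : M.El t0) then (1 : M.El t0) else 0,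
    fun Y => ?_⟩
  rw [lam_app]
  have hcont : Cont (F Y) ↔ ¬ ∃ f, InC f ∧ (0 : M.El t0) < Y f := by
    refine ⟨fun hc ⟨f, hf, h⟩ => ?_, fun hc f => ⟨0, fun g _ => ?_⟩⟩
    · obtain ⟨N, hN⟩ := hc f
      let g : M.El t1 := lam fun n : M.El t0 => if n < N then (f n : M.El t0) else f n + (1 + 1)
      have hg : ∀ n : M.El t0, g n = if n < N then (f n : M.El t0) else f n + (1 + 1) :=
        fun n => lam_app _ n
      have hpg : p g = f := M.ext _ _ fun n => by
        have even : ∀ k : M.El t0, k + k = (half : M.El t1) (k + k) + (half : M.El t1) (k + k) :=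
          fun k => by rw [half_double]
        have odd : ∀ k : M.El t0,
            k + k + 1 ≠ (half : M.El t1) (k + k + 1) + (half : M.El t1) (k + k + 1) :=
          fun k => double_ne.symm
        rw [hp, hg]
        rcases le_one_iff.1 (hf n) with h | h <;> rw [h] <;> by_cases hn : n < N
        · rw [if_pos hn, if_pos]
          simpa only [add_zero] using even 0
        · rw [if_neg hn, if_pos]
          simpa only [zero_add] using even 1
        · rw [if_pos hn, if_neg]
          simpa only [add_zero, zero_add] using odd 0
        · rw [if_neg hn, if_neg]
          simpa only [add_assoc] using odd 1
      have h1 := hN g fun i hi => by rw [hg, if_pos hi]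
      rw [hF, hF, hpg, if_neg, if_pos] at h1
      · exact zero_ne_one h1
      · refine ⟨h, N, ?_⟩
        rw [hg, if_neg (lt_irrefl N)]
        exact (lt_add_one 1).trans_le (le_add_of_nonneg_left (zero_le' _))
      · rintro ⟨-, n, hn⟩
        exact hn.not_ge (hf n)
    · have hne : ∀ h : M.El t1, ¬ (0 < (Y (p h) : M.El t0) ∧ ∃ n : M.El t0, 1 < (h n : M.El t0)) :=
        fun h hh => hc ⟨p h, hpC h, hh.1⟩
      rw [hF, hF, if_neg (hne f), if_neg (hne g)]
  split_ifs with h <;> rw [hZ, hcont] at h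
  · exact iff_of_false one_ne_zero h
  · exact iff_of_true rfl (not_not.1 h)

theorem HasKappa.iff {V : Ctx} {ρ : ∀ σ, V σ → M.El σ} (hM : M.Sat ρ WKL)
    (hC : ∀ A : Fm M.El, QFAC t2 t0 M.El A → M.Sat M.self A) :
    HasKappa M ↔ HasZ M ∧ HasFF M := by
  constructor
  · intro h
    have hZ := h.hasZ
    exact ⟨hZ, h.hasFF hM hC⟩
  · rintro ⟨hZ, hFF⟩
    by_cases hE : HasE2 M
    · exact hasKappa_of_hasE2
    · exact hasKappa_of_not_hasE2 hE

end Model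

end HOA

open HOA in
theorem mainTheorem3 :
    HOA.Proves (HOA.WKL0ω.plus (HOA.QFAC HOA.Ty.t2 HOA.Ty.t0))
      (HOA.kappa0.iff (HOA.Z3.and HOA.FF)) := by
  have hWKL : Theory.SubstClosed fun _ => {WKL} := by
    rintro V W u A rfl
    rfl
  refine Proves.of_models ((substClosed_RCA0ω.plus hWKL).plus (substClosed_QFAC _ _))
    (fun V A h => Or.inl (Or.inl h)) fun M hM ρ => ?_
  have : M.RCA := ⟨fun h => hM _ _ (Or.inl (Or.inl h))⟩
  rw [Model.sat_iff, Model.sat_and, Model.sat_kappa0, Model.sat_Z3, Model.sat_FF]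
  exact Model.HasKappa.iff (hM _ _ (Or.inl (Or.inr rfl)) ρ) fun A hA => hM _ _ (Or.inr hA) _
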